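/- For $d \ge 0$ let $\mathbb{T}_d$ be the $d$-regular tree with root $\circ$, and for $d \geq 1$ let $\circ'$ be a fixed neighbour of $\circ$. A factor of iid (FIID) percolation process on $\mathbb{T}_d$ is a process $\mathbf{Y} = (\mathbf{Y}(v))_{v \in V(\mathbb{T}_d)}$ of the form $\mathbf{Y}(v) = f(\gamma_{v\to\circ}\cdot \mathbf{X})$, where $\mathbf{X} = (X(v))_{v \in V(\mathbb{T}_d)}$ consists of independent labels uniform on $[0,1]$, $f : [0,1]^{V(\mathbb{T}_d)} \to \{0,1\}$ is measurable for the product Borel $\sigma$-algebra and invariant under all root-preserving automorphisms of $\mathbb{T}_d$, automorphisms act on labellings by $(\gamma\cdot\omega)(v) = \omega(\gamma^{-1}v)$, and $\gamma_{v\to\circ}$ is any automorphism taking $v$ to $\circ$. Its density, correlation ratio and average degree are $$\mathrm{den}(\mathbf{Y}) = \mathbb{P}[\mathbf{Y}(\circ)=1], \qquad \mathrm{corr}(\mathbf{Y}) = \frac{\mathbb{P}[\mathbf{Y}(\circ)=1,\ \mathbf{Y}(\circ')=1]}{\mathbb{P}[\mathbf{Y}(\circ)=1]\,\mathbb{P}[\mathbf{Y}(\circ')=1]},$$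 $$\mathrm{avdeg}(\mathbf{Y}) = \mathbb{E}\big[\#\{v \sim \circ : \mathbf{Y}(v)=1\}\ \big|\ \mathbf{Y}(\circ)=1\big],$$ where the last two are taken to be $0$ if $\mathrm{den}(\mathbf{Y}) = 0$. Theorem. Let $\{\mathbf{Y}_d\}$ be a sequence of FIID percolation processes, where $\mathbf{Y}_d$ is a percolation process on $\mathbb{T}_d$. If $\mathrm{corr}(\mathbf{Y}_d) \to 0$ as $d \to \infty$, then $$\limsup_{d\to\infty} \frac{\mathrm{den}(\mathbf{Y}_d)}{(\log d)/d} \le 1.$$ Likewise, if $\mathrm{avdeg}(\mathbf{Y}_d) = o(\log d)$ as $d \to \infty$, then $$\limsup_{d\to\infty} \frac{\mathrm{den}(\mathbf{Y}_d)}{(\log d)/d} \le 1.$$ -/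

import Mathlib

open MeasureTheory ProbabilityTheory Filter Topology

/-- Vertices of the `d`-regular tree: words in the letters `Fin d` without two equal consecutive
letters (the elements of the free product of `d` copies of the group of order two). -/
abbrev RegularTree.Vertex (d : ℕ) : Type :=
  {l : List (Fin d) // l.IsChain (· ≠ ·)}

/-- The `d`-regular tree: two reduced words are adjacent when one of them arises from the other
by appending one letter. -/
def regularTree (d : ℕ) : SimpleGraph (RegularTree.Vertex d) where
  Adj u v := ∃ a : Fin d, v.1 = u.1 ++ [a] ∨ u.1 = v.1 ++ [a]
  symm := ⟨fun _ _ ⟨a, h⟩ => ⟨a, h.symm⟩⟩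
  loopless := ⟨fun _ ⟨_, h⟩ => by simp at h⟩

/-- The root of the `d`-regular tree: the empty word. -/
def RegularTree.root (d : ℕ) : RegularTree.Vertex d := ⟨[], List.isChain_nil⟩

namespace RegularTree

variable {d : ℕ}

/-- Every vertex of `regularTree d` has exactly `d` neighbours. -/
theorem encard_neighborSet (u : Vertex d) : ((regularTree d).neighborSet u).encard = d := by
  classical
  obtain ⟨l, hl⟩ := u
  have key : Nonempty ((regularTree d).neighborSet ⟨l, hl⟩ ≃ Fin d) := by
    rcases List.eq_nil_or_concat l with rfl | ⟨t, b, rfl⟩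
    · refine ⟨(Equiv.ofBijective
        (fun a : Fin d => (⟨⟨[a], by simp⟩, ⟨a, Or.inl rfl⟩⟩ :
          (regularTree d).neighborSet ⟨[], hl⟩)) ⟨?_, ?_⟩).symm⟩
      · intro a b h
        simpa using congrArg (fun w => w.1.1) h
      · rintro ⟨⟨v, hv⟩, a, h | h⟩
        · exact ⟨a, Subtype.ext (Subtype.ext (by simpa using h.symm))⟩
        · simp at h
    · rw [List.concat_eq_append] at hl
      simp only [List.concat_eq_append]
      have ht : t.IsChain (· ≠ ·) := (List.isChain_append.1 hl).1
      refine ⟨(Equiv.ofBijective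
        (fun a : Fin d => if h : a = b then
          (⟨⟨t, ht⟩, ⟨b, Or.inr rfl⟩⟩ : (regularTree d).neighborSet ⟨t ++ [b], hl⟩)
          else ⟨⟨t ++ [b] ++ [a], by
            rw [List.isChain_append]
            exact ⟨hl, by simp, by simpa using fun h' => h h'.symm⟩⟩, ⟨a, Or.inl rfl⟩⟩) ⟨?_, ?_⟩).symm⟩
      · intro a a' h
        by_cases h1 : a = b <;> by_cases h2 : a' = b
        · exact h1.trans h2.symm
        · have := congrArg (fun w => w.1.1.length) h
          simp [h1, h2] at this
        · have := congrArg (fun w => w.1.1.length) h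
          simp [h1, h2] at this
        · simpa [h1, h2] using h
      · rintro ⟨⟨v, hv⟩, a, h | h⟩
        · simp only at h
          subst h
          have hab : a ≠ b := by
            have := (List.isChain_append.1 hv).2.2
            simpa [eq_comm] using this
          exact ⟨a, by simp [hab]⟩
        · have := List.append_inj' h rfl
          exact ⟨b, by simp [this.1]⟩
  obtain ⟨e⟩ := key
  rw [Set.encard_congr (t := (Set.univ : Set (Fin d))) (e.trans (Equiv.Set.univ _).symm)]
  simp

theorem isTree : (regularTree d).IsTree := by
  have hreach : ∀ (l : List (Fin d)) (hl : l.IsChain (· ≠ ·)),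
      (regularTree d).Reachable (root d) ⟨l, hl⟩ := by
    intro l
    induction l using List.reverseRecOn with
    | nil => exact fun _ => SimpleGraph.Reachable.refl _
    | append_singleton t b ih =>
      intro hl
      have ht : t.IsChain (· ≠ ·) := (List.isChain_append.1 hl).1
      exact (ih ht).trans (SimpleGraph.Adj.reachable ⟨b, Or.inl rfl⟩)
  have aux : ∀ (u v : Vertex d) (a : Fin d), v.1 = u.1 ++ [a] →
      (regularTree d).IsBridge s(u, v) := by
    intro u v a h
    rw [SimpleGraph.isBridge_iff]
    rintro ⟨p⟩
    have inv : ∀ (x y : Vertex d),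
        ((regularTree d).deleteEdges {s(u, v)}).Walk x y → v.1 <+: y.1 → v.1 <+: x.1 := by
      intro x y p
      induction p with
      | nil => exact id
      | @cons x z y hxz _ ih =>
        intro hy
        have hz := ih hy
        rw [SimpleGraph.deleteEdges_adj] at hxz
        obtain ⟨⟨c, hc | hc⟩, hne⟩ := hxz
        · rw [hc, List.prefix_concat_iff] at hz
          rcases hz with hz | hz
          · exfalso
            have hvz : v = z := Subtype.ext (hz.trans hc.symm)
            have hux : u = x := Subtype.ext (List.append_inj' (h.symm.trans hz) rfl).1
            exact hne (by simp [hvz, hux])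
          · exact hz
        · exact hz.trans (hc ▸ List.prefix_append _ _)
    have := (inv u v p (List.prefix_refl _)).length_le
    simp [h] at this
  have : Nonempty (Vertex d) := ⟨root d⟩
  refine ⟨⟨fun u v => (hreach u.1 u.2).symm.trans (hreach v.1 v.2)⟩,
    SimpleGraph.isAcyclic_iff_forall_adj_isBridge.2 ?_⟩
  rintro u v ⟨a, h | h⟩
  · exact aux u v a h
  · rw [Sym2.eq_swap]; exact aux v u a h

/-- Multiplication by a letter from the left, followed by reduction. -/
def shift (a : Fin d) (u : Vertex d) : Vertex d :=
  if h : u.1.head? = some a then ⟨u.1.tail, u.2.tail⟩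
  else ⟨a :: u.1, List.isChain_cons.2 ⟨fun _ hy e => h (e ▸ hy), u.2⟩⟩

theorem shift_shift (a : Fin d) (u : Vertex d) : shift a (shift a u) = u := by
  obtain ⟨l, hl⟩ := u
  rcases l with _ | ⟨b, t⟩
  · simp [shift]
  · by_cases h : b = a
    · subst h
      have : t.head? ≠ some b := fun e => (List.isChain_cons.1 hl).1 b e rfl
      simp [shift, this]
    · simp [shift, h]

theorem adj_shift (a : Fin d) {u v : Vertex d} (c : Fin d) (h : v.1 = u.1 ++ [c]) :
    (regularTree d).Adj (shift a u) (shift a v) := by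
  obtain ⟨l, hl⟩ := u
  obtain ⟨m, hm⟩ := v
  simp only at h
  subst h
  rcases l with _ | ⟨b, t⟩
  · by_cases h : c = a
    · subst h
      exact ⟨c, Or.inr (by simp [shift])⟩
    · exact ⟨c, Or.inl (by simp [shift, h])⟩
  · by_cases h : b = a
    · exact ⟨c, Or.inl (by simp [shift, h])⟩
    · exact ⟨c, Or.inl (by simp [shift, h])⟩

/-- `shift a` as an automorphism of the tree. -/
def shiftIso (a : Fin d) : regularTree d ≃g regularTree d where
  toFun := shift a
  invFun := shift a
  left_inv := shift_shift a
  right_inv := shift_shift a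
  map_rel_iff' := by
    have key : ∀ u v : Vertex d, (regularTree d).Adj u v →
        (regularTree d).Adj (shift a u) (shift a v) := by
      rintro u v ⟨c, h | h⟩
      · exact adj_shift a c h
      · exact (adj_shift a c h).symm
    intro u v
    refine ⟨fun h => ?_, key u v⟩
    have := key _ _ h
    rwa [Equiv.coe_fn_mk, shift_shift, shift_shift] at this

/-- The automorphism group acts transitively: every vertex can be moved to the root. -/
theorem exists_iso_eq_root (v : Vertex d) : ∃ γ : regularTree d ≃g regularTree d, γ v = root d := by
  obtain ⟨l, hl⟩ := v
  induction l with
  | nil => exact ⟨SimpleGraph.Iso.refl, rfl⟩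
  | cons a t ih =>
    obtain ⟨γ, hγ⟩ := ih hl.tail
    refine ⟨(shiftIso a).trans γ, ?_⟩
    have : shiftIso a ⟨a :: t, hl⟩ = ⟨t, hl.tail⟩ := by simp [shiftIso, shift]
    rw [RelIso.trans_apply, this, hγ]

end RegularTree

section FIID

variable {V : Type*} {Ω : Type*} [MeasurableSpace Ω] {χ : Type*} [MeasurableSpace χ]

/-- The action of the automorphism group of `G` on labellings: `(γ · ω)(v) = ω(γ⁻¹ v)`. -/
def relabel {G : SimpleGraph V} {L : Type*} (γ : G ≃g G) (ω : V → L) : V → L :=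
  fun v => ω (γ.symm v)

/-- `X` is a random labelling: independent labels, each uniform on `[0,1]`. -/
structure IsRandomLabelling (P : Measure Ω) (X : V → Ω → unitInterval) : Prop where
  measurable : ∀ v, Measurable (X v)
  uniform : ∀ v, P.map (X v) = volume
  indep : iIndepFun X P

/-- `f` is a factor on `G` rooted at `o`: it is measurable for the product Borel `σ`-algebra and
invariant under the root-preserving automorphisms. -/
structure IsFactor (G : SimpleGraph V) (o : V) (f : (V → unitInterval) → χ) : Prop where
  measurable : Measurable f
  invariant : ∀ γ : G ≃g G, γ o = o → ∀ ω, f (relabel γ ω) = f ω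

/-- The process `Y` on the vertices of the (vertex-transitive) graph `G` rooted at `o` is a factor
of iid: `Y(v) = f(γ · X)` for a factor `f`, a random labelling `X`, and any automorphism `γ` that
takes `v` to the root. -/
def IsFIID (G : SimpleGraph V) (o : V) (P : Measure Ω) (Y : V → Ω → χ) : Prop :=
  ∃ (X : V → Ω → unitInterval) (f : (V → unitInterval) → χ),
    IsRandomLabelling P X ∧ IsFactor G o f ∧
      ∀ (v : V) (γ : G ≃g G), γ v = o → ∀ x, Y v x = f (relabel γ fun u => X u x)

/-- The density `ℙ(Y(o) = 1)` of a site percolation process. -/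
noncomputable def density (o : V) (P : Measure Ω) (Y : V → Ω → Fin 2) : ℝ :=
  P.real {x | Y o x = 1}

/-- The correlation ratio `ℙ(Y(o) = 1, Y(o') = 1) / (ℙ(Y(o) = 1) ℙ(Y(o') = 1))`. -/
noncomputable def corrRatio (o o' : V) (P : Measure Ω) (Y : V → Ω → Fin 2) : ℝ :=
  P.real {x | Y o x = 1 ∧ Y o' x = 1} / (P.real {x | Y o x = 1} * P.real {x | Y o' x = 1})

/-- The average degree `𝔼[#{v ∼ o : Y(v) = 1} | Y(o) = 1]`. -/
noncomputable def avgDegree (G : SimpleGraph V) (o : V) (P : Measure Ω) (Y : V → Ω → Fin 2) : ℝ :=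
  ∫ x, (Set.ncard {v | G.Adj o v ∧ Y v x = 1} : ℝ) ∂(P[|{x | Y o x = 1}])

end FIID

/-! The proof plays an upper bound for the information carried by the edges of the tree against a
lower bound.

Upper bound (`edge_vertex_entropy`): for a block factor of iid labels, the joint entropies along the
d edges at the root add up to at least 2(d-1)H, where H is the entropy at one vertex; equivalently,
the mutual informations across these edges total at most 2H. For the proof, a finite group that
looks like the tree up to the relevant radius replaces the tree, and the labels are revealed one at
a time. A label at x informs only about vertices in a ball around x, and each of these has at least
d-1 edges leading away from x.

Lower bound (`le_mutualInfo`): an event that is likely when the two ends are independent, but rare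
for the actual pair, forces information. For one process of density ρ with few occupied edges this
gives about ρ² per edge, while H is about ρ log d; hence only dρ ≤ 2 log d.

The factor 2 is removed by running k = m² coupled copies (`exists_coupling`), with the coupling
tuned so that some copy is occupied at a vertex with probability q = mρ. The vector of copies has
entropy at most about q log d. The event "some copy is occupied at both ends" has probability at
least 2qρ - ρ² - q²/k = (2m-2)ρ² for independent ends (`sum_mixedTrials_ge`), but actually at most k
times the edge density. So d(2m-2)ρ² is at most about 2mρ log d (`density_entropy_le`), and large m
gives the constant 1.

After approximation by block factors, a density ρ ≥ α(log d)/d with α > 1 therefore forces total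
edge probability above εdρ² at the root (`exists_edge_density_lower_bound`), which contradicts both
a vanishing correlation ratio and an average degree o(log d). -/

/-! ### Shannon entropy on finite weighted spaces. -/

section FiniteEntropy

open Finset Real

variable {α β γ κ : Type*} [Fintype α]

/-- `w` is a probability weight on a finite type. -/
structure IsWeight (w : α → ℝ) : Prop where
  nonneg : ∀ a, 0 ≤ w a
  sum_eq : ∑ a, w a = 1

open Classical in
/-- The image of a weight under a map. -/
noncomputable def pushWeight (w : α → ℝ) (Z : α → β) (b : β) : ℝ := ∑ a, if Z a = b then w a else 0

open Classical in
theorem pushWeight_eq_sum_mul (w : α → ℝ) (Z : α → β) (b : β) :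
    pushWeight w Z b = ∑ a, w a * if Z a = b then 1 else 0 := by
  simp [pushWeight]

theorem pushWeight_nonneg {w : α → ℝ} (hw : ∀ a, 0 ≤ w a) (Z : α → β) (b : β) :
    0 ≤ pushWeight w Z b :=
  Finset.sum_nonneg fun a _ => by split_ifs <;> simp [hw a]

theorem le_pushWeight {w : α → ℝ} (hw : ∀ a, 0 ≤ w a) (Z : α → β) (a : α) :
    w a ≤ pushWeight w Z (Z a) := by
  classical
  have := Finset.single_le_sum (f := fun a' => if Z a' = Z a then w a' else 0)
    (fun a' _ => by split_ifs <;> simp [hw a']) (Finset.mem_univ a)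
  simpa [pushWeight] using this

variable [Fintype β]

/-- The Shannon entropy of a weight. -/
noncomputable def weightEntropy (w : α → ℝ) : ℝ := ∑ a, negMulLog (w a)

/-- The Shannon entropy of a random variable on a finite weighted space. -/
noncomputable def varEntropy (w : α → ℝ) (Z : α → β) : ℝ := weightEntropy (pushWeight w Z)

theorem sum_pushWeight_mul (w : α → ℝ) (Z : α → β) (g : β → ℝ) :
    ∑ b, pushWeight w Z b * g b = ∑ a, w a * g (Z a) := by
  classical
  simp only [pushWeight, Finset.sum_mul]
  rw [Finset.sum_comm]
  refine Finset.sum_congr rfl fun a _ => ?_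
  simp [ite_mul]

theorem sum_pushWeight (w : α → ℝ) (Z : α → β) : ∑ b, pushWeight w Z b = ∑ a, w a := by
  simpa using sum_pushWeight_mul w Z fun _ => 1

theorem pushWeight_pushWeight (w : α → ℝ) (Z : α → β) (g : β → γ) :
    pushWeight (pushWeight w Z) g = pushWeight w fun a => g (Z a) := by
  classical
  ext c
  rw [pushWeight_eq_sum_mul, pushWeight_eq_sum_mul,
    sum_pushWeight_mul w Z fun b => if g b = c then 1 else 0]

variable [Fintype γ] [Fintype κ]

theorem IsWeight.push {w : α → ℝ} (hw : IsWeight w) (Z : α → β) : IsWeight (pushWeight w Z) :=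
  ⟨pushWeight_nonneg hw.nonneg Z, by rw [sum_pushWeight, hw.sum_eq]⟩

theorem varEntropy_eq (w : α → ℝ) (Z : α → β) :
    varEntropy w Z = -∑ a, w a * log (pushWeight w Z (Z a)) := by
  rw [varEntropy, weightEntropy, ← sum_pushWeight_mul w Z fun b => log (pushWeight w Z b),
    ← Finset.sum_neg_distrib]
  exact Finset.sum_congr rfl fun b _ => by rw [negMulLog]; ring

theorem varEntropy_comp (w : α → ℝ) (Z : α → β) (g : β → γ) :
    varEntropy w (fun a => g (Z a)) = varEntropy (pushWeight w Z) g := by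
  rw [varEntropy, varEntropy, pushWeight_pushWeight]

/-- Entropy depends only on the partition into level sets. This is how tuples with redundant or
reordered entries are identified below. -/
theorem varEntropy_congr (w : α → ℝ) {Z : α → β} {Z' : α → γ}
    (h : ∀ a a', Z a = Z a' ↔ Z' a = Z' a') : varEntropy w Z = varEntropy w Z' := by
  classical
  rw [varEntropy_eq, varEntropy_eq]
  simp only [pushWeight, h]

/-- Strong subadditivity of entropy. -/
theorem varEntropy_submodular {w : α → ℝ} (hw : IsWeight w) (A : α → β) (B : α → γ) (C : α → κ) :
    varEntropy w (fun x => (A x, B x, C x)) + varEntropy w C ≤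
      varEntropy w (fun x => (A x, C x)) + varEntropy w (fun x => (B x, C x)) := by
  classical
  set p := pushWeight w fun x => (A x, B x, C x)
  set pA := pushWeight w fun x => (A x, C x)
  set pB := pushWeight w fun x => (B x, C x)
  set pC := pushWeight w C
  have h0 := hw.nonneg
  -- Gibbs' inequality: the likelihood ratio of the conditionally independent law to the true one
  -- has mean at most 1, and log t ≤ t - 1 turns this into the entropy inequality.
  have key : ∑ x, w x * (pA (A x, C x) * pB (B x, C x) / (p (A x, B x, C x) * pC (C x))) ≤ 1 := by
    have e : ∑ x, w x * (pA (A x, C x) * pB (B x, C x) / (p (A x, B x, C x) * pC (C x))) =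
        ∑ z, p z * (pA (z.1, z.2.2) * pB (z.2.1, z.2.2) / (p z * pC z.2.2)) :=
      (sum_pushWeight_mul w (fun x => (A x, B x, C x)) fun z =>
        pA (z.1, z.2.2) * pB (z.2.1, z.2.2) / (p z * pC z.2.2)).symm
    have hpA : ∀ c, ∑ a, pA (a, c) = pC c := fun c => by
      simp only [pA, pC, pushWeight]
      rw [Finset.sum_comm]
      exact Finset.sum_congr rfl fun x _ => by simp [Prod.ext_iff, ite_and]
    have hpB : ∀ c, ∑ b, pB (b, c) = pC c := fun c => by
      simp only [pB, pC, pushWeight]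
      rw [Finset.sum_comm]
      exact Finset.sum_congr rfl fun x _ => by simp [Prod.ext_iff, ite_and]
    calc _ = _ := e
      _ ≤ ∑ z : β × γ × κ, pA (z.1, z.2.2) * pB (z.2.1, z.2.2) / pC z.2.2 := by
        refine Finset.sum_le_sum fun z _ => ?_
        have hn : 0 ≤ pA (z.1, z.2.2) * pB (z.2.1, z.2.2) / pC z.2.2 :=
          div_nonneg (mul_nonneg (pushWeight_nonneg h0 _ _) (pushWeight_nonneg h0 _ _))
            (pushWeight_nonneg h0 _ _)
        rcases eq_or_ne (p z) 0 with h | h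
        · simpa [h] using hn
        · rw [← mul_div_assoc, mul_div_mul_left _ _ h]
      _ = ∑ c, (∑ a, pA (a, c)) * (∑ b, pB (b, c)) / pC c := by
        rw [Fintype.sum_prod_type]
        simp only [Fintype.sum_prod_type, Finset.sum_mul_sum, Finset.sum_div]
        rw [Finset.sum_congr rfl fun a _ => Finset.sum_comm, Finset.sum_comm]
      _ = ∑ c, pC c := Finset.sum_congr rfl fun c _ => by
        rw [hpA, hpB, mul_self_div_self]
      _ = 1 := (hw.push C).sum_eq
  have hpt : ∀ x, w x * (log (pA (A x, C x)) + log (pB (B x, C x)) - log (p (A x, B x, C x))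
      - log (pC (C x))) ≤
      w x * (pA (A x, C x) * pB (B x, C x) / (p (A x, B x, C x) * pC (C x))) - w x := fun x => by
    rcases (h0 x).eq_or_lt with h | h
    · simp [← h]
    · have a1 : 0 < pA (A x, C x) := h.trans_le (le_pushWeight h0 (fun x => (A x, C x)) x)
      have a2 : 0 < pB (B x, C x) := h.trans_le (le_pushWeight h0 (fun x => (B x, C x)) x)
      have a3 : 0 < p (A x, B x, C x) :=
        h.trans_le (le_pushWeight h0 (fun x => (A x, B x, C x)) x)
      have a4 : 0 < pC (C x) := h.trans_le (le_pushWeight h0 C x)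
      have := log_le_sub_one_of_pos (div_pos (mul_pos a1 a2) (mul_pos a3 a4))
      rw [log_div (mul_pos a1 a2).ne' (mul_pos a3 a4).ne', log_mul a1.ne' a2.ne',
        log_mul a3.ne' a4.ne'] at this
      nlinarith
  have hsum := Finset.sum_le_sum fun x (_ : x ∈ (Finset.univ : Finset α)) => hpt x
  rw [Finset.sum_sub_distrib, hw.sum_eq] at hsum
  simp only [varEntropy_eq]
  simp only [mul_sub, mul_add, Finset.sum_sub_distrib, Finset.sum_add_distrib] at hsum
  linarith

theorem varEntropy_prod_eq_add {w : α → ℝ} (hw : IsWeight w) (A : α → β) (B : α → γ)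
    (h : ∀ a b, pushWeight w (fun x => (A x, B x)) (a, b) = pushWeight w A a * pushWeight w B b) :
    varEntropy w (fun x => (A x, B x)) = varEntropy w A + varEntropy w B := by
  simp only [varEntropy_eq, h]
  rw [← neg_add, ← Finset.sum_add_distrib]
  congr 1
  refine Finset.sum_congr rfl fun x _ => ?_
  rcases (hw.nonneg x).eq_or_lt with h | h
  · simp [← h]
  · rw [log_mul (h.trans_le (le_pushWeight hw.nonneg A x)).ne'
      (h.trans_le (le_pushWeight hw.nonneg B x)).ne']
    ring

open Classical in
/-- A lower bound for the mutual information of two variables by means of one event. -/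
theorem le_mutualInfo {w : α → ℝ} (hw : IsWeight w) (A : α → β) (B : α → γ) (E : β → γ → Prop)
    {δ : ℝ} (hδ : 0 < δ) :
    (1 - δ) * (∑ a, ∑ b, pushWeight w A a * pushWeight w B b * if E a b then 1 else 0) +
        log δ * ∑ x, w x * (if E (A x) (B x) then 1 else 0) ≤
      varEntropy w A + varEntropy w B - varEntropy w (fun x => (A x, B x)) := by
  set p := pushWeight w fun x => (A x, B x)
  set pA := pushWeight w A
  set pB := pushWeight w B
  have h0 := hw.nonneg
  -- Gibbs' inequality against the product law tilted by δ on the event; the tilted law has total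
  -- mass 1 - (1-δ) times the product probability of the event.
  set g : β → γ → ℝ := fun a b => if E a b then δ else 1
  have hg : ∀ a b, 0 < g a b := fun a b => by simp only [g]; split_ifs <;> simp [hδ]
  have key : ∑ x, w x * (pA (A x) * pB (B x) * g (A x) (B x) / p (A x, B x)) ≤
      1 - (1 - δ) * ∑ a, ∑ b, pA a * pB b * if E a b then 1 else 0 := by
    have e : ∑ x, w x * (pA (A x) * pB (B x) * g (A x) (B x) / p (A x, B x)) =
        ∑ z, p z * (pA z.1 * pB z.2 * g z.1 z.2 / p z) :=
      (sum_pushWeight_mul w (fun x => (A x, B x)) fun z =>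
        pA z.1 * pB z.2 * g z.1 z.2 / p z).symm
    calc _ = _ := e
      _ ≤ ∑ z : β × γ, pA z.1 * pB z.2 * g z.1 z.2 := by
        refine Finset.sum_le_sum fun z _ => ?_
        have hn : 0 ≤ pA z.1 * pB z.2 * g z.1 z.2 :=
          mul_nonneg (mul_nonneg (pushWeight_nonneg h0 _ _) (pushWeight_nonneg h0 _ _)) (hg _ _).le
        rcases eq_or_ne (p z) 0 with h | h
        · simpa [h] using hn
        · rw [mul_div_cancel₀ _ h]
      _ = ∑ a, ∑ b, (pA a * pB b - (1 - δ) * (pA a * pB b * if E a b then 1 else 0)) := by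
        rw [Fintype.sum_prod_type]
        refine Finset.sum_congr rfl fun a _ => Finset.sum_congr rfl fun b _ => ?_
        simp only [g]
        split_ifs <;> ring
      _ = _ := by
        simp only [Finset.sum_sub_distrib, ← Finset.mul_sum]
        rw [← Finset.sum_mul, (hw.push A).sum_eq, (hw.push B).sum_eq]
        ring
  have hpt : ∀ x, w x * (log (pA (A x)) + log (pB (B x)) - log (p (A x, B x))
      + log δ * if E (A x) (B x) then 1 else 0) ≤
      w x * (pA (A x) * pB (B x) * g (A x) (B x) / p (A x, B x)) - w x := fun x => by
    rcases (h0 x).eq_or_lt with h | h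
    · simp [← h]
    · have a1 : 0 < pA (A x) := h.trans_le (le_pushWeight h0 A x)
      have a2 : 0 < pB (B x) := h.trans_le (le_pushWeight h0 B x)
      have a3 : 0 < p (A x, B x) := h.trans_le (le_pushWeight h0 (fun x => (A x, B x)) x)
      have := log_le_sub_one_of_pos (div_pos (mul_pos (mul_pos a1 a2) (hg (A x) (B x))) a3)
      rw [log_div (mul_pos (mul_pos a1 a2) (hg _ _)).ne' a3.ne',
        log_mul (mul_pos a1 a2).ne' (hg _ _).ne', log_mul a1.ne' a2.ne'] at this
      have hgl : log (g (A x) (B x)) = log δ * if E (A x) (B x) then 1 else 0 := by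
        simp only [g]; split_ifs <;> simp
      rw [hgl] at this
      nlinarith
  have hsum := Finset.sum_le_sum fun x (_ : x ∈ (Finset.univ : Finset α)) => hpt x
  rw [Finset.sum_sub_distrib, hw.sum_eq] at hsum
  simp only [varEntropy_eq]
  have : ∑ x, w x * (log (pA (A x)) + log (pB (B x)) - log (p (A x, B x))
      + log δ * if E (A x) (B x) then 1 else 0) = ∑ x, w x * log (pA (A x)) +
      ∑ x, w x * log (pB (B x)) - ∑ x, w x * log (p (A x, B x)) +
      log δ * ∑ x, w x * (if E (A x) (B x) then 1 else 0) := by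
    rw [Finset.mul_sum, ← Finset.sum_add_distrib, ← Finset.sum_sub_distrib,
      ← Finset.sum_add_distrib]
    exact Finset.sum_congr rfl fun x _ => by ring
  linarith

/-- The entropy of a weight that is concentrated near one point. -/
theorem weightEntropy_le {w : α → ℝ} (hw : IsWeight w) (o : α) {ρ : ℝ} (hρ : 0 < ρ)
    (hq : ρ ≤ 1 - w o) :
    weightEntropy w ≤ (1 - w o) * (1 + log (Fintype.card α) + log (1 / ρ)) := by
  classical
  have hcard : (0 : ℝ) < Fintype.card α := by
    exact_mod_cast Fintype.card_pos_iff.2 ⟨o⟩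
  set n : ℝ := (Fintype.card α : ℝ) with hn
  -- Tangent bound for `negMulLog` at r: the surplus over the remaining points is at most n r = ρ,
  -- which the mass `1 - w o` absorbs.
  set r := ρ / n
  have hr : 0 < r := div_pos hρ hcard
  have h1 : negMulLog (w o) ≤ 1 - w o := by
    rcases (hw.nonneg o).eq_or_lt with h | h
    · simp [← h]
    · have := one_sub_inv_le_log_of_pos h
      rw [negMulLog]
      have h2 := mul_le_mul_of_nonneg_left this h.le
      rw [mul_sub, mul_inv_cancel₀ h.ne'] at h2
      linarith
  have h2 : ∀ a, negMulLog (w a) ≤ w a * log (1 / r) + r - w a := fun a => by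
    rcases (hw.nonneg a).eq_or_lt with h | h
    · simp [← h, hr.le]
    · have := log_le_sub_one_of_pos (div_pos hr h)
      rw [log_div hr.ne' h.ne'] at this
      have h2 := mul_le_mul_of_nonneg_left this h.le
      rw [mul_sub, mul_sub, mul_div_cancel₀ _ h.ne'] at h2
      rw [negMulLog, one_div, log_inv]
      linarith
  have hsplit : ∀ g : α → ℝ, ∑ a, g a = g o + ∑ a ∈ univ.erase o, g a := fun g =>
    (Finset.add_sum_erase _ _ (Finset.mem_univ o)).symm
  have hws : ∑ a ∈ univ.erase o, w a = 1 - w o := by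
    have := hsplit w
    rw [hw.sum_eq] at this
    linarith
  have h3 : ∑ a ∈ univ.erase o, negMulLog (w a) ≤ (1 - w o) * log (1 / r) := by
    calc _ ≤ ∑ a ∈ univ.erase o, (w a * log (1 / r) + r - w a) :=
          Finset.sum_le_sum fun a _ => h2 a
      _ = (1 - w o) * log (1 / r) + (univ.erase o).card * r - (1 - w o) := by
        rw [Finset.sum_sub_distrib, Finset.sum_add_distrib, ← Finset.sum_mul, hws]
        simp
      _ ≤ _ := by
        have : ((univ.erase o).card : ℝ) ≤ n := by
          rw [hn]; exact_mod_cast Finset.card_le_univ _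
        have h4 : ((univ.erase o).card : ℝ) * r ≤ n * r :=
          mul_le_mul_of_nonneg_right this hr.le
        have h5 : n * r = ρ := mul_div_cancel₀ _ hcard.ne'
        linarith
  have hlog : log (1 / r) = log n + log (1 / ρ) := by
    rw [one_div, one_div, log_inv, log_inv, log_div hρ.ne' hcard.ne']
    ring
  rw [weightEntropy, hsplit]
  rw [hlog] at h3
  nlinarith

end FiniteEntropy

/-! ### Independent labels, revealed one at a time. -/

section ProductWeight

open Finset Real

variable {V B σ τ χ χ' : Type*} [Fintype V] [DecidableEq V] [Fintype B] [DecidableEq B]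
  [Fintype σ] [Fintype τ]

/-- The weight of independent identically distributed labels. -/
noncomputable def prodWeight (V : Type*) [Fintype V] {σ : Type*} (μ : σ → ℝ) (ω : V → σ) : ℝ :=
  ∏ v, μ (ω v)

omit [DecidableEq V] [Fintype σ] in
theorem prodWeight_nonneg {μ : σ → ℝ} (hμ : ∀ s, 0 ≤ μ s) (ω : V → σ) : 0 ≤ prodWeight V μ ω :=
  Finset.prod_nonneg fun _ _ => hμ _

theorem IsWeight.prodWeight {μ : σ → ℝ} (hμ : IsWeight μ) : IsWeight (prodWeight V μ) := by
  refine ⟨prodWeight_nonneg hμ.nonneg, ?_⟩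
  have := Finset.prod_univ_sum (fun _ : V => (Finset.univ : Finset σ)) fun _ s => μ s
  simpa [_root_.prodWeight, hμ.sum_eq] using this.symm

theorem sum_prod_eq_prod_sum (g : V → σ → ℝ) : ∑ ω : V → σ, ∏ v, g v (ω v) = ∏ v, ∑ s, g v s := by
  rw [Finset.prod_univ_sum]; simp

omit [DecidableEq B] in
/-- The labels along an injection are again independent and identically distributed. -/
theorem pushWeight_prodWeight_comp {μ : σ → ℝ} (hμ : IsWeight μ) {i : B → V}
    (hi : Function.Injective i) :
    pushWeight (prodWeight V μ) (fun ω b => ω (i b)) = prodWeight B μ := by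
  classical
  ext η
  have h1 : ∀ ω : V → σ, (if (fun b => ω (i b)) = η then prodWeight V μ ω else 0) =
      ∏ v, μ (ω v) * if ∀ b, i b = v → ω v = η b then 1 else 0 := fun ω => by
    rw [Finset.prod_mul_distrib, prodWeight]
    split_ifs with h
    · rw [Finset.prod_eq_one (f := fun v => if ∀ b, i b = v → ω v = η b then (1 : ℝ) else 0),
        mul_one]
      rintro v -
      rw [if_pos]
      rintro b rfl
      exact congrFun h b
    · obtain ⟨b, hb⟩ := Function.ne_iff.1 h
      rw [Finset.prod_eq_zero (f := fun v => if ∀ b, i b = v → ω v = η b then (1 : ℝ) else 0)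
        (Finset.mem_univ (i b)), mul_zero]
      rw [if_neg]
      exact fun h => hb (h b rfl)
  have h2 : pushWeight (prodWeight V μ) (fun ω b => ω (i b)) η =
      ∑ ω : V → σ, ∏ v, μ (ω v) * if ∀ b, i b = v → ω v = η b then 1 else 0 :=
    Finset.sum_congr rfl fun ω _ => by rw [← h1 ω]; congr
  rw [h2, sum_prod_eq_prod_sum fun v s => μ s * if ∀ b, i b = v → s = η b then 1 else 0]
  rw [← Finset.prod_subset (Finset.subset_univ (Finset.univ.image i)), Finset.prod_image hi.injOn]
  · refine Finset.prod_congr rfl fun b _ => ?_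
    rw [Finset.sum_eq_single (η b)]
    · rw [if_pos, mul_one]
      intro b' h
      rw [hi h]
    · intro s _ hs
      rw [if_neg, mul_zero]
      exact fun h => hs (h b rfl)
    · simp
  · intro v _ hv
    refine Eq.trans (Finset.sum_congr rfl fun s _ => ?_) hμ.sum_eq
    rw [if_pos, mul_one]
    intro b hb
    exact absurd (Finset.mem_image.2 ⟨b, Finset.mem_univ _, hb⟩) hv

omit [Fintype τ] in
/-- Mapping every label maps the product weight to a product weight. -/
theorem pushWeight_prodWeight_map (μ : σ → ℝ) (m : σ → τ) :
    pushWeight (prodWeight V μ) (fun ω v => m (ω v)) = prodWeight V (pushWeight μ m) := by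
  classical
  ext η
  simp only [prodWeight, pushWeight]
  rw [← sum_prod_eq_prod_sum fun v s => if m s = η v then μ s else 0]
  refine Finset.sum_congr rfl fun ω _ => ?_
  rw [Finset.prod_ite_zero]
  simp [funext_iff]

omit [Fintype σ] in
theorem prodWeight_update_mul (μ : σ → ℝ) (ω : V → σ) (x : V) (s : σ) :
    prodWeight V μ (Function.update ω x s) * μ (ω x) = prodWeight V μ ω * μ s := by
  rw [prodWeight, prodWeight, ← Finset.mul_prod_erase univ _ (Finset.mem_univ x),
    ← Finset.mul_prod_erase univ (fun v => μ (ω v)) (Finset.mem_univ x)]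
  rw [Finset.prod_congr rfl (g := fun v => μ (ω v))]
  · simp; ring
  · intro v hv
    rw [Function.update_of_ne (Finset.ne_of_mem_erase hv)]

/-- A variable that does not depend on the label at `x` is independent of this label. -/
theorem pushWeight_prod_eval {μ : σ → ℝ} (hμ : IsWeight μ) (x : V) (Z : (V → σ) → χ)
    (hZ : ∀ ω s, Z (Function.update ω x s) = Z ω) (z : χ) (s : σ) :
    pushWeight (prodWeight V μ) (fun ω => (Z ω, ω x)) (z, s) =
      pushWeight (prodWeight V μ) Z z * μ s := by
  classical
  -- Exchanging the label at x with an independent fresh label preserves the joint weight and does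
  -- not change Z.
  have hinv : Function.Involutive
      (fun q : (V → σ) × σ => (Function.update q.1 x q.2, q.1 x)) := fun q => by simp
  set e := hinv.toPerm
  have := Equiv.sum_comp e fun q : (V → σ) × σ =>
    prodWeight V μ q.1 * μ q.2 * if Z q.1 = z ∧ q.1 x = s then 1 else 0
  have h2 : ∀ q : (V → σ) × σ, e q = (Function.update q.1 x q.2, q.1 x) := fun q => rfl
  simp only [h2, hZ, prodWeight_update_mul, Function.update_self] at this
  rw [Fintype.sum_prod_type, Fintype.sum_prod_type] at this
  rw [pushWeight_eq_sum_mul, pushWeight_eq_sum_mul, Finset.sum_mul]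
  calc _ = ∑ ω, ∑ s', prodWeight V μ ω * μ s' * (if Z ω = z ∧ ω x = s then 1 else 0) := by
        refine Finset.sum_congr rfl fun ω _ => ?_
        rw [← Finset.sum_mul, ← Finset.mul_sum, hμ.sum_eq]
        simp
    _ = _ := this.symm
    _ = _ := by
      refine Finset.sum_congr rfl fun ω _ => ?_
      by_cases h : Z ω = z <;> simp [h]

theorem pushWeight_prodWeight_eval {μ : σ → ℝ} (hμ : IsWeight μ) (x : V) (s : σ) :
    pushWeight (prodWeight V μ) (fun ω => ω x) s = μ s := by
  have h1 := pushWeight_prod_eval hμ x (fun _ : V → σ => ()) (fun _ _ => rfl) () s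
  have h2 : pushWeight (prodWeight V μ) (fun _ => ()) () = 1 := by
    have := (hμ.prodWeight (V := V)).push (fun _ => ())
    simpa using this.sum_eq
  rw [h2, one_mul] at h1
  refine Eq.trans (Finset.sum_congr rfl fun ω _ => ?_) h1
  by_cases h : ω x = s <;> simp [h]

/-- The labels on `S`, the others being erased. -/
def mask (S : Finset V) (ω : V → σ) (v : V) : Option σ := if v ∈ S then some (ω v) else none

omit [Fintype V] [Fintype σ] in
theorem mask_eq_mask {S : Finset V} {ω ω' : V → σ} :
    mask S ω = mask S ω' ↔ ∀ v ∈ S, ω v = ω' v := by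
  simp only [funext_iff, mask]
  refine forall_congr' fun v => ?_
  split_ifs with h <;> simp [h]

variable [Fintype χ] [Fintype χ']

/-- The conditional mutual information of `Z` and the label at `x` given the labels on `S`. -/
noncomputable def labelInfo (μ : σ → ℝ) (S : Finset V) (x : V) (Z : (V → σ) → χ) : ℝ :=
  (varEntropy (prodWeight V μ) (fun ω => (Z ω, mask S ω)) -
    varEntropy (prodWeight V μ) (mask S)) -
  (varEntropy (prodWeight V μ) (fun ω => (Z ω, mask (insert x S) ω)) -
    varEntropy (prodWeight V μ) (mask (insert x S)))

/-- By the chain rule the difference of the two sides is the conditional mutual information of Z and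
the label at x, given g(Z) and the labels on S. Strong subadditivity makes it nonnegative. -/
theorem labelInfo_comp_le {μ : σ → ℝ} (hμ : IsWeight μ) (S : Finset V) (x : V)
    (Z : (V → σ) → χ) (g : χ → χ') :
    labelInfo μ S x (fun ω => g (Z ω)) ≤ labelInfo μ S x Z := by
  have := varEntropy_submodular hμ.prodWeight Z (mask (insert x S))
    (fun ω : V → σ => (g (Z ω), mask S ω))
  rw [varEntropy_congr (prodWeight V μ) (Z := fun ω => (Z ω, mask (insert x S) ω, g (Z ω), mask S ω))
      (Z' := fun ω => (Z ω, mask (insert x S) ω)),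
    varEntropy_congr (prodWeight V μ) (Z := fun ω => (Z ω, g (Z ω), mask S ω))
      (Z' := fun ω => (Z ω, mask S ω)),
    varEntropy_congr (prodWeight V μ) (Z := fun ω => (mask (insert x S) ω, g (Z ω), mask S ω))
      (Z' := fun ω => (g (Z ω), mask (insert x S) ω))] at this
  · simp only [labelInfo]
    linarith
  all_goals
    intro ω ω'
    simp only [Prod.mk.injEq, mask_eq_mask]
    grind

theorem labelInfo_nonneg {μ : σ → ℝ} (hμ : IsWeight μ) (S : Finset V) (x : V)
    (Z : (V → σ) → χ) : 0 ≤ labelInfo μ S x Z := by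
  refine le_trans (le_of_eq ?_) (labelInfo_comp_le hμ S x Z fun _ => ())
  have h : ∀ T : Finset V, varEntropy (prodWeight V μ) (fun ω => ((), mask (σ := σ) T ω)) =
      varEntropy (prodWeight V μ) (mask T) := fun T => varEntropy_congr _ (by simp)
  simp [labelInfo, h]

/-- The label at x is independent of Z and the labels on S together, so its entropy is added to both
terms with x and cancels. -/
theorem labelInfo_eq_zero {μ : σ → ℝ} (hμ : IsWeight μ) {S : Finset V} {x : V} (hx : x ∉ S)
    (Z : (V → σ) → χ) (hZ : ∀ ω s, Z (Function.update ω x s) = Z ω) : labelInfo μ S x Z = 0 := by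
  have hm : ∀ (ω : V → σ) s, mask S (Function.update ω x s) = mask S ω := fun ω s => by
    rw [mask_eq_mask]
    intro v hv
    rw [Function.update_of_ne]
    rintro rfl
    exact hx hv
  have h1 : varEntropy (prodWeight V μ) (fun ω => (Z ω, mask (insert x S) ω)) =
      varEntropy (prodWeight V μ) (fun ω => (Z ω, mask S ω)) +
        varEntropy (prodWeight V μ) (fun ω => ω x) := by
    rw [← varEntropy_prod_eq_add hμ.prodWeight]
    · refine varEntropy_congr _ fun ω ω' => ?_
      simp only [Prod.mk.injEq, mask_eq_mask]
      grind
    · intro a b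
      rw [pushWeight_prod_eval hμ x _ (fun ω s => by rw [hZ, hm]), pushWeight_prodWeight_eval hμ]
  have h2 : varEntropy (prodWeight V μ) (mask (insert x S)) =
      varEntropy (prodWeight V μ) (mask (σ := σ) S) +
        varEntropy (prodWeight V μ) (fun ω => ω x) := by
    rw [← varEntropy_prod_eq_add hμ.prodWeight]
    · refine varEntropy_congr _ fun ω ω' => ?_
      simp only [Prod.mk.injEq, mask_eq_mask]
      grind
    · intro a b
      rw [pushWeight_prod_eval hμ x _ hm, pushWeight_prodWeight_eval hμ]
  rw [labelInfo, h1, h2]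
  ring

/-- An expansion inequality for the dependency sets gives an entropy inequality. -/
theorem mul_sum_varEntropy_le {ι : Type*} [Fintype ι] {μ : σ → ℝ} (hμ : IsWeight μ)
    (nbr : V → ι → V) (c : ℝ) (dep : V → V → Prop) (Y : V → (V → σ) → χ)
    (hY : ∀ v x, ¬ dep v x → ∀ ω s, Y v (Function.update ω x s) = Y v ω)
    (hexp : ∀ x, ∀ g : V → ℝ, (∀ v, 0 ≤ g v) → (∀ v, ¬ dep v x → g v = 0) →
      c * ∑ v, g v ≤ ∑ v, ∑ a, max (g v) (g (nbr v a))) :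
    c * ∑ v, varEntropy (prodWeight V μ) (Y v) ≤
      ∑ v, ∑ a, varEntropy (prodWeight V μ) (fun ω => (Y v ω, Y (nbr v a) ω)) := by
  -- The same inequality for the mutual information with the labels revealed so far; each new label
  -- contributes one instance of `hexp`.
  have key : ∀ S : Finset V,
      c * ∑ v, (varEntropy (prodWeight V μ) (Y v) -
        (varEntropy (prodWeight V μ) (fun ω => (Y v ω, mask S ω)) -
          varEntropy (prodWeight V μ) (mask (σ := σ) S))) ≤
      ∑ v, ∑ a, (varEntropy (prodWeight V μ) (fun ω => (Y v ω, Y (nbr v a) ω)) -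
        (varEntropy (prodWeight V μ) (fun ω => ((Y v ω, Y (nbr v a) ω), mask S ω)) -
          varEntropy (prodWeight V μ) (mask (σ := σ) S))) := by
    intro S
    induction S using Finset.induction_on with
    | empty =>
      have h0 : varEntropy (prodWeight V μ) (mask (σ := σ) (∅ : Finset V)) = 0 := by
        rw [varEntropy_congr _ (Z' := fun _ => ()) (by simp [mask_eq_mask])]
        have : pushWeight (prodWeight V μ) (fun _ : V → σ => ()) () = 1 := by
          simpa using ((hμ.prodWeight (V := V)).push (fun _ => ())).sum_eq
        simp [varEntropy, weightEntropy, this]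
      have h1 : ∀ v, varEntropy (prodWeight V μ) (fun ω => (Y v ω, mask ∅ ω)) =
          varEntropy (prodWeight V μ) (Y v) := fun v =>
        varEntropy_congr _ (by simp [mask_eq_mask])
      have h2 : ∀ v a, varEntropy (prodWeight V μ)
          (fun ω => ((Y v ω, Y (nbr v a) ω), mask ∅ ω)) =
          varEntropy (prodWeight V μ) (fun ω => (Y v ω, Y (nbr v a) ω)) := fun v a =>
        varEntropy_congr _ (by simp [mask_eq_mask])
      simp [h0, h1, h2]
    | insert x S hx ih =>
      have h1 := hexp x (fun v => labelInfo μ S x (Y v)) (fun v => labelInfo_nonneg hμ S x _)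
        (fun v hv => labelInfo_eq_zero hμ hx _ (hY v x hv))
      have h2 : ∑ v, ∑ a, max (labelInfo μ S x (Y v)) (labelInfo μ S x (Y (nbr v a))) ≤
          ∑ v, ∑ a, labelInfo μ S x (fun ω => (Y v ω, Y (nbr v a) ω)) :=
        Finset.sum_le_sum fun v _ => Finset.sum_le_sum fun a _ => max_le
          (labelInfo_comp_le hμ S x (fun ω => (Y v ω, Y (nbr v a) ω)) Prod.fst)
          (labelInfo_comp_le hμ S x (fun ω => (Y v ω, Y (nbr v a) ω)) Prod.snd)
      have h3 := add_le_add ih (h1.trans h2)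
      rw [← mul_add, ← Finset.sum_add_distrib, ← Finset.sum_add_distrib] at h3
      simp only [← Finset.sum_add_distrib, labelInfo] at h3
      refine (le_of_eq ?_).trans (h3.trans (le_of_eq ?_))
      · congr 1
        exact Finset.sum_congr rfl fun v _ => by ring
      · exact Finset.sum_congr rfl fun v _ => Finset.sum_congr rfl fun a _ => by ring
  -- Once all labels are revealed, nothing is left of the conditional entropies, and the information
  -- is the full entropy.
  have h1 : ∀ v, varEntropy (prodWeight V μ) (fun ω => (Y v ω, mask univ ω)) =
      varEntropy (prodWeight V μ) (mask (σ := σ) univ) := fun v => by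
    refine varEntropy_congr _ fun ω ω' => ?_
    simp only [Prod.mk.injEq, mask_eq_mask, Finset.mem_univ, forall_const]
    exact ⟨fun h => h.2, fun h => ⟨by rw [funext h], h⟩⟩
  have h2 : ∀ v a, varEntropy (prodWeight V μ)
      (fun ω => ((Y v ω, Y (nbr v a) ω), mask univ ω)) =
      varEntropy (prodWeight V μ) (mask (σ := σ) univ) := fun v a => by
    refine varEntropy_congr _ fun ω ω' => ?_
    simp only [Prod.mk.injEq, mask_eq_mask, Finset.mem_univ, forall_const]
    exact ⟨fun h => h.2, fun h => ⟨by rw [funext h]; simp, h⟩⟩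
  simpa [h1, h2] using key univ

end ProductWeight

/-! ### A finite group that is locally a tree, and the edge-vertex inequality. -/

namespace RegularTree

variable {d : ℕ}

/-- The ball of radius `r` around the root. -/
abbrev Ball (d r : ℕ) : Type := {u : Vertex d // u.1.length ≤ r}

noncomputable instance (r : ℕ) : Fintype (Ball d r) :=
  haveI : Finite {l : List (Fin d) // l.length ≤ r} := List.finite_length_le (Fin d) r
  haveI : Finite (Ball d r) := Finite.of_injective
    (fun u : Ball d r => (⟨u.1.1, u.2⟩ : {l : List (Fin d) // l.length ≤ r}))
    fun _ _ h => Subtype.ext (Subtype.ext (Subtype.mk.inj h))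
  Fintype.ofFinite _

theorem shift_of_head?_ne {a : Fin d} {u : Vertex d} (h : u.1.head? ≠ some a) :
    (shift a u).1 = a :: u.1 := by simp [shift, h]

theorem length_shift_le (a : Fin d) (u : Vertex d) : (shift a u).1.length ≤ u.1.length + 1 := by
  unfold shift
  split_ifs <;> simp
  omega

/-- Multiplication by a letter, where it does not leave the ball. -/
def truncShift (N : ℕ) (a : Fin d) (u : Ball d N) : Ball d N :=
  if h : (shift a u.1).1.length ≤ N then ⟨shift a u.1, h⟩ else u

theorem truncShift_involutive (N : ℕ) (a : Fin d) :
    Function.Involutive (truncShift N a : Ball d N → Ball d N) := by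
  intro u
  by_cases h : (shift a u.1).1.length ≤ N
  · simp [truncShift, h, shift_shift, u.2]
  · simp [truncShift, h]

/-- The permutation of the ball that is given by a letter. -/
def letterPerm (N : ℕ) (a : Fin d) : Equiv.Perm (Ball d N) := (truncShift_involutive N a).toPerm

theorem letterPerm_mul_self (N : ℕ) (a : Fin d) : letterPerm N a * letterPerm N a = 1 :=
  Equiv.ext (truncShift_involutive N a)

/-- The permutation of the ball that is given by a word. -/
def wordPerm (N : ℕ) (l : List (Fin d)) : Equiv.Perm (Ball d N) := (l.map (letterPerm N)).prod

theorem wordPerm_apply_root (N : ℕ) (l : List (Fin d)) (hl : l.IsChain (· ≠ ·))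
    (h : l.length ≤ N) : wordPerm N l ⟨root d, Nat.zero_le _⟩ = ⟨⟨l, hl⟩, h⟩ := by
  induction l with
  | nil => rfl
  | cons a t ih =>
    have hs : t.head? ≠ some a := fun e => (List.isChain_cons.1 hl).1 a e rfl
    have ht : t.length ≤ N := (Nat.le_succ _).trans h
    have e1 : wordPerm N (a :: t) = letterPerm N a * wordPerm N t := by simp [wordPerm]
    rw [e1, Equiv.Perm.mul_apply, ih hl.tail ht]
    have e2 : shift a ⟨t, hl.tail⟩ = ⟨a :: t, hl⟩ := Subtype.ext (shift_of_head?_ne hs)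
    change truncShift N a _ = _
    simp only [truncShift, e2]
    rw [dif_pos h]

/-- The image of the root recovers the word. Hence the Cayley graph of these permutations shows no
coincidences among reduced words up to length N. -/
theorem wordPerm_injective {N : ℕ} {u v : Vertex d} (hu : u.1.length ≤ N) (hv : v.1.length ≤ N)
    (h : wordPerm N u.1 = wordPerm N v.1) : u = v := by
  have h1 := wordPerm_apply_root N u.1 u.2 hu
  rw [h, wordPerm_apply_root N v.1 v.2 hv] at h1
  exact (congrArg Subtype.val h1).symm

theorem wordPerm_shift (N : ℕ) (a : Fin d) (u : Vertex d) :
    wordPerm N (shift a u).1 = letterPerm N a * wordPerm N u.1 := by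
  obtain ⟨l, hl⟩ := u
  by_cases h : l.head? = some a
  · obtain ⟨t, rfl⟩ : ∃ t, l = a :: t := by
      cases l <;> simp_all
    simp [shift, wordPerm, ← mul_assoc, letterPerm_mul_self]
  · rw [shift_of_head?_ne h]
    simp [wordPerm]

/-- The inclusion of a ball into the next one. -/
def Ball.incl {r : ℕ} (u : Ball d r) : Ball d (r + 1) := ⟨u.1, u.2.trans (Nat.le_succ r)⟩

/-- The translation of a ball by a letter. -/
def Ball.translate {r : ℕ} (a : Fin d) (u : Ball d r) : Ball d (r + 1) :=
  ⟨shift a u.1, (length_shift_le a u.1).trans (Nat.succ_le_succ u.2)⟩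

-- The function g lives on a ball around x. Each edge there is charged to the endpoint, if any, from
-- which it leads away from x; a vertex of the ball has at least d-1 such edges. The factor 2 arises
-- because the double sum meets every edge from both ends.
open Finset in
theorem ball_expansion {r : ℕ} (x : Equiv.Perm (Ball d (r + 1)))
    (g : Equiv.Perm (Ball d (r + 1)) → ℝ) (hg : ∀ v, 0 ≤ g v)
    (hx : ∀ v, (¬ ∃ w : Ball d r, v * wordPerm (r + 1) w.1.1 = x) → g v = 0) :
    2 * ((d : ℝ) - 1) * ∑ v, g v ≤ ∑ v, ∑ a, max (g v) (g (v * letterPerm (r + 1) a)) := by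
  classical
  -- The word w leads from v to x; the step a leads away from x exactly when w does not begin with
  -- a.
  set O : Equiv.Perm (Ball d (r + 1)) → Fin d → Prop := fun v a =>
    ∃ w : Ball d r, v * wordPerm (r + 1) w.1.1 = x ∧ w.1.1.head? ≠ some a
  have hO : ∀ v a, O v a → ¬ O (v * letterPerm (r + 1) a) a := by
    rintro v a ⟨w, hw, hwa⟩ ⟨w', hw', hwa'⟩
    rw [mul_assoc, ← wordPerm_shift, ← hw] at hw'
    have h1 := wordPerm_injective (w'.translate a).2 (w.incl).2 (mul_left_cancel hw')
    apply hwa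
    have h2 : (shift a w'.1).1 = w.1.1 := congrArg Subtype.val h1
    rw [← h2, shift_of_head?_ne hwa']
    rfl
  have h1 : ∀ v a, (if O v a then g v else 0) +
      (if O (v * letterPerm (r + 1) a) a then g (v * letterPerm (r + 1) a) else 0) ≤
      max (g v) (g (v * letterPerm (r + 1) a)) := fun v a => by
    by_cases h : O v a
    · simp [h, hO v a h]
    · simp only [h, if_false, zero_add]
      split_ifs
      · exact le_max_right _ _
      · exact le_max_of_le_left (hg v)
  have h2 : ∑ v, ∑ a, (if O (v * letterPerm (r + 1) a) a then
      g (v * letterPerm (r + 1) a) else 0) = ∑ v, ∑ a, if O v a then g v else 0 := by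
    rw [Finset.sum_comm, Finset.sum_comm (f := fun v a => if O v a then g v else 0)]
    exact Finset.sum_congr rfl fun a _ =>
      Equiv.sum_comp (Equiv.mulRight (letterPerm (r + 1) a)) fun v => if O v a then g v else 0
  have h3 : ∀ v, ((d : ℝ) - 1) * g v ≤ ∑ a, if O v a then g v else 0 := fun v => by
    by_cases hv : ∃ w : Ball d r, v * wordPerm (r + 1) w.1.1 = x
    · obtain ⟨w, hw⟩ := hv
      rw [← Finset.sum_filter, Finset.sum_const, nsmul_eq_mul]
      refine mul_le_mul_of_nonneg_right ?_ (hg v)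
      have hsub : univ.filter (fun a => w.1.1.head? ≠ some a) ⊆ univ.filter fun a => O v a := by
        intro a ha
        rw [mem_filter] at ha ⊢
        exact ⟨ha.1, w, hw, ha.2⟩
      have hcard := Finset.card_le_card hsub
      have hle : d ≤ #(univ.filter (fun a : Fin d => w.1.1.head? ≠ some a)) + 1 := by
        have h4 := Finset.card_filter_add_card_filter_not (s := (univ : Finset (Fin d)))
          (fun a => w.1.1.head? ≠ some a)
        have h5 : #(univ.filter fun a : Fin d => ¬ w.1.1.head? ≠ some a) ≤ 1 := by
          rw [Finset.card_le_one]
          intro a ha b hb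
          simp only [ne_eq, not_not, mem_filter, mem_univ, true_and] at ha hb
          exact Option.some.inj (ha.symm.trans hb)
        rw [Finset.card_univ, Fintype.card_fin] at h4
        omega
      have h6 : (d : ℝ) ≤ (#(univ.filter fun a => O v a) : ℝ) + 1 := by
        exact_mod_cast hle.trans (Nat.succ_le_succ hcard)
      linarith
    · rw [hx v hv, mul_zero]
      exact Finset.sum_nonneg fun a _ => by split_ifs <;> simp
  have h4 := Finset.sum_le_sum fun v (_ : v ∈ (univ : Finset (Equiv.Perm (Ball d (r + 1))))) =>
    Finset.sum_le_sum fun a (_ : a ∈ (univ : Finset (Fin d))) => h1 v a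
  simp only [Finset.sum_add_distrib] at h4
  rw [h2] at h4
  have h5 := Finset.sum_le_sum fun v (_ : v ∈ (univ : Finset (Equiv.Perm (Ball d (r + 1))))) =>
    h3 v
  rw [← Finset.mul_sum] at h5
  linarith

/-- The edge-vertex entropy inequality for block factors of independent labels on the tree. -/
theorem edge_vertex_entropy {σ χ : Type*} [Fintype σ] [Fintype χ] {μ : σ → ℝ} (hμ : IsWeight μ)
    {r : ℕ} (F : (Ball d r → σ) → χ) :
    2 * ((d : ℝ) - 1) * varEntropy (prodWeight (Ball d r) μ) F ≤
      ∑ a, varEntropy (prodWeight (Ball d (r + 1)) μ)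
        (fun η => (F fun u => η u.incl, F fun u => η (u.translate a))) := by
  classical
  -- Radius r + 1 suffices for the r-balls around both ends of an edge to be read from distinct
  -- labels.
  set V := Equiv.Perm (Ball d (r + 1))
  set p : Ball d (r + 1) → V := fun w => wordPerm (r + 1) w.1.1
  have hp : Function.Injective p := fun u v h => Subtype.ext (wordPerm_injective u.2 v.2 h)
  have hv : ∀ v : V, Function.Injective fun w => v * p w :=
    fun v => (mul_right_injective v).comp hp
  have hincl : Function.Injective (Ball.incl : Ball d r → Ball d (r + 1)) := fun u v h =>
    Subtype.ext (congrArg (fun w : Ball d (r + 1) => w.1) h)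
  set Y : V → (V → σ) → χ := fun v ω => F fun w => ω (v * p w.incl)
  have main := mul_sum_varEntropy_le hμ (fun v a => v * letterPerm (r + 1) a)
    (2 * ((d : ℝ) - 1)) (fun v x => ∃ w : Ball d r, v * p w.incl = x) Y
    (fun v x hx ω s => by
      refine congrArg F (funext fun w => ?_)
      rw [Function.update_of_ne fun h => hx ⟨w, h⟩])
    (fun x g hg hx => ball_expansion x g hg hx)
  have h1 : ∀ v, varEntropy (prodWeight V μ) (Y v) = varEntropy (prodWeight (Ball d r) μ) F :=
    fun v => by
    rw [← pushWeight_prodWeight_comp hμ ((hv v).comp hincl), ← varEntropy_comp]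
    rfl
  have h2 : ∀ v a, varEntropy (prodWeight V μ)
      (fun ω => (Y v ω, Y (v * letterPerm (r + 1) a) ω)) =
      varEntropy (prodWeight (Ball d (r + 1)) μ)
        (fun η => (F fun u => η u.incl, F fun u => η (u.translate a))) := fun v a => by
    rw [← pushWeight_prodWeight_comp hμ (hv v), ← varEntropy_comp]
    congr 1
    funext ω
    refine Prod.ext rfl (congrArg F (funext fun w => congrArg ω ?_))
    rw [mul_assoc]
    exact congrArg (v * ·) (wordPerm_shift (r + 1) a w.1).symm
  rw [Finset.sum_congr rfl fun v _ => h1 v,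
    Finset.sum_congr rfl fun v _ => Finset.sum_congr rfl fun a _ => h2 v a] at main
  simp only [Finset.sum_const, nsmul_eq_mul] at main
  have hc : (0 : ℝ) < (Finset.univ : Finset V).card := by
    exact_mod_cast Finset.card_pos.2 ⟨1, Finset.mem_univ _⟩
  rw [mul_left_comm] at main
  exact le_of_mul_le_mul_left main hc

end RegularTree

/-! ### A polynomial inequality for the hitting probability of k trials. -/

section GeometricSum

open Finset

/-- The sum of `1 - (1 - x) ^ j` over `j < k`. -/
def coGeomSum (x : ℝ) (k : ℕ) : ℝ := ∑ j ∈ range k, (1 - (1 - x) ^ j)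

theorem coGeomSum_succ (x : ℝ) (k : ℕ) :
    coGeomSum x (k + 1) = coGeomSum x k + (1 - (1 - x) ^ k) := Finset.sum_range_succ _ _

theorem mul_coGeomSum (x : ℝ) (k : ℕ) : x * (k - coGeomSum x k) = 1 - (1 - x) ^ k := by
  induction k with
  | zero => simp [coGeomSum]
  | succ n ih =>
    rw [coGeomSum_succ, pow_succ]
    push_cast
    linear_combination ih

theorem coGeomSum_succ' (x : ℝ) (k : ℕ) :
    coGeomSum x (k + 1) = x * k + (1 - x) * coGeomSum x k := by
  rw [coGeomSum_succ]
  linear_combination -mul_coGeomSum x k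

theorem coGeomSum_mono {x y : ℝ} (hxy : x ≤ y) (hy : y ≤ 1) (k : ℕ) :
    coGeomSum x k ≤ coGeomSum y k := by
  refine Finset.sum_le_sum fun j _ => ?_
  have := pow_le_pow_left₀ (sub_nonneg.2 hy) (sub_le_sub_left hxy 1) j
  linarith

theorem coGeomSum_le {x : ℝ} (hx : x ≤ 1) (k : ℕ) : coGeomSum x k ≤ k := by
  have : coGeomSum x k ≤ ∑ j ∈ range k, 1 := Finset.sum_le_sum fun j _ => by
    have := pow_nonneg (sub_nonneg.2 hx) j
    linarith
  simpa using this

/-- The summands increase with their index, so the averages of the first j of them increase with j.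
-/
theorem mul_coGeomSum_le {y : ℝ} (h0 : 0 ≤ y) (h1 : y ≤ 1) {j k : ℕ} (hjk : j ≤ k) :
    k * coGeomSum y j ≤ j * coGeomSum y k := by
  induction k, hjk using Nat.le_induction with
  | base => rfl
  | succ k hjk ih =>
    have h2 : coGeomSum y j ≤ j * (1 - (1 - y) ^ k) := by
      have : coGeomSum y j ≤ ∑ i ∈ range j, (1 - (1 - y) ^ k) :=
        Finset.sum_le_sum fun i hi => by
          have := pow_le_pow_of_le_one (sub_nonneg.2 h1) (by linarith : 1 - y ≤ 1)
            ((Finset.mem_range.1 hi).le.trans hjk)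
          linarith
      rwa [Finset.sum_const, Finset.card_range, nsmul_eq_mul] at this
    rw [coGeomSum_succ]
    push_cast
    linarith

theorem mul_coGeomSum_mul_le {x y : ℝ} (hx0 : 0 ≤ x) (hx1 : x ≤ 1) (hy0 : 0 ≤ y) (hy1 : y ≤ 1)
    {k : ℕ} (hk : 0 < k) :
    k * coGeomSum (x * y) k ≤ k + coGeomSum x k * coGeomSum y k := by
  have hk' : (0 : ℝ) < k := by exact_mod_cast hk
  set t := coGeomSum y k / k with ht
  have htk : t * k = coGeomSum y k := div_mul_cancel₀ _ hk'.ne'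
  have ht1 : t ≤ 1 := by
    rw [ht, div_le_one hk']
    exact coGeomSum_le hy1 k
  -- Induction by the recursion `coGeomSum_succ'`, with 1 - xy = (1-x) + x(1-y): the first part uses
  -- the induction hypothesis, the second the monotonicity `h1`.
  have key : ∀ n ≤ k, coGeomSum (x * y) n ≤ (1 - (1 - x) ^ n) + coGeomSum x n * t := by
    intro n hn
    induction n with
    | zero => simp [coGeomSum]
    | succ n ih =>
      have ih := ih ((Nat.le_succ n).trans hn)
      have h1 : coGeomSum (x * y) n ≤ coGeomSum y n :=
        coGeomSum_mono (mul_le_of_le_one_left hy0 hx1) hy1 n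
      have h2 : coGeomSum y (n + 1) ≤ n * t + 1 := by
        have h3 := mul_coGeomSum_le hy0 hy1 hn
        rw [← htk, mul_comm t, mul_left_comm] at h3
        have h4 := le_of_mul_le_mul_left h3 hk'
        push_cast at h4
        linarith
      have h5 : x * (1 - y) * coGeomSum (x * y) n ≤ x * (1 - y) * coGeomSum y n :=
        mul_le_mul_of_nonneg_left h1 (mul_nonneg hx0 (sub_nonneg.2 hy1))
      have h6 := mul_le_mul_of_nonneg_left h2 hx0
      have h7 := mul_le_mul_of_nonneg_left ih (sub_nonneg.2 hx1)
      rw [coGeomSum_succ' (x * y), coGeomSum_succ' x]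
      rw [coGeomSum_succ' y] at h6
      rw [pow_succ]
      linarith
  have h1 := key k le_rfl
  have h2 : 0 ≤ (1 - x) ^ k := pow_nonneg (sub_nonneg.2 hx1) k
  have h3 := mul_le_mul_of_nonneg_left h1 hk'.le
  rw [← htk]
  nlinarith

/-- Each term of the lower bound is a function of x times a function of y, so averaging over
independent x and y leaves only the means of x and of 1 - (1-x)^k. -/
theorem one_sub_one_sub_mul_pow_ge {x y : ℝ} (hx0 : 0 ≤ x) (hx1 : x ≤ 1) (hy0 : 0 ≤ y)
    (hy1 : y ≤ 1) {k : ℕ} (hk : 0 < k) :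
    (1 - (1 - x) ^ k) * y + x * (1 - (1 - y) ^ k) - x * y -
      (1 - (1 - x) ^ k) * (1 - (1 - y) ^ k) / k ≤ 1 - (1 - x * y) ^ k := by
  have hk' : (0 : ℝ) < k := by exact_mod_cast hk
  rw [← mul_coGeomSum, ← mul_coGeomSum, ← mul_coGeomSum]
  have h := mul_le_mul_of_nonneg_left (mul_coGeomSum_mul_le hx0 hx1 hy0 hy1 hk)
    (mul_nonneg hx0 hy0)
  have e : x * (k - coGeomSum x k) * y + x * (y * (k - coGeomSum y k)) - x * y -
      x * (k - coGeomSum x k) * (y * (k - coGeomSum y k)) / k =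
      (x * y * (k * k - k - coGeomSum x k * coGeomSum y k)) / k := by
    field_simp
    ring
  rw [e, div_le_iff₀ hk']
  nlinarith

end GeometricSum

/-! ### Trials that are independent given a random success probability. -/

section ConditionallyIndependent

open Finset

variable {C : Type*} [Fintype C] {k : ℕ}

/-- The probability of the outcome `A` of `k` independent trials with success probability `t`. -/
def trialsWeight (t : ℝ) (A : Fin k → Bool) : ℝ := ∏ i, if A i then t else 1 - t

/-- The law of `k` trials that are independent given a random success probability. -/
noncomputable def mixedTrials (K : C → ℝ) (Q : C → ℝ) (A : Fin k → Bool) : ℝ :=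
  ∑ c, K c * trialsWeight (Q c) A

theorem mixedTrials_false (K Q : C → ℝ) :
    mixedTrials K Q (fun _ : Fin k => false) = ∑ c, K c * (1 - Q c) ^ k := by
  simp [mixedTrials, trialsWeight]

theorem sum_trialsWeight_mul_trialsWeight (s t : ℝ) :
    ∑ A : Fin k → Bool, ∑ B : Fin k → Bool, trialsWeight s A * trialsWeight t B *
      (if ∃ i, A i = true ∧ B i = true then 1 else 0) = 1 - (1 - s * t) ^ k := by
  -- The probability of no common success factorizes over the k coordinates.
  have h1 : ∑ A : Fin k → Bool, ∑ B : Fin k → Bool, trialsWeight s A * trialsWeight t B *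
      (if ∃ i, A i = true ∧ B i = true then 0 else 1) = (1 - s * t) ^ k := by
    have h : ∀ A B : Fin k → Bool, trialsWeight s A * trialsWeight t B *
        (if ∃ i, A i = true ∧ B i = true then (0 : ℝ) else 1) =
        ∏ i, (if A i then s else 1 - s) * (if B i then t else 1 - t) *
          (if A i = true ∧ B i = true then 0 else 1) := fun A B => by
      rw [Finset.prod_mul_distrib, Finset.prod_mul_distrib, trialsWeight, trialsWeight]
      congr 1
      split_ifs with h
      · obtain ⟨i, hi⟩ := h
        exact (Finset.prod_eq_zero (Finset.mem_univ i) (by simp [hi])).symm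
      · refine (Finset.prod_eq_one fun i _ => ?_).symm
        rw [if_neg fun hi => h ⟨i, hi⟩]
    simp only [h]
    have h2 : ∀ A : Fin k → Bool, ∑ B : Fin k → Bool, ∏ i,
        (if A i then s else 1 - s) * (if B i then t else 1 - t) *
          (if A i = true ∧ B i = true then 0 else 1) =
        ∏ i, ∑ b : Bool, (if A i then s else 1 - s) * (if b then t else 1 - t) *
          (if A i = true ∧ b = true then 0 else 1) := fun A =>
      sum_prod_eq_prod_sum fun i b => (if A i then s else 1 - s) * (if b then t else 1 - t) *
          (if A i = true ∧ b = true then 0 else 1)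
    simp only [h2]
    rw [sum_prod_eq_prod_sum fun (i : Fin k) a => ∑ b : Bool,
      (if a = true then s else 1 - s) * (if b then t else 1 - t) *
          (if a = true ∧ b = true then 0 else 1)]
    simp
    ring
  have h2 : ∀ s : ℝ, ∑ A : Fin k → Bool, trialsWeight s A = 1 := fun s => by
    simp only [trialsWeight]
    rw [sum_prod_eq_prod_sum fun (i : Fin k) (a : Bool) => if a = true then s else 1 - s]
    simp
  have h3 : ∑ A : Fin k → Bool, ∑ B : Fin k → Bool, trialsWeight s A * trialsWeight t B = 1 := by
    simp only [← Finset.mul_sum, h2, mul_one]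
  rw [eq_sub_iff_add_eq, ← h1, ← Finset.sum_add_distrib]
  refine Eq.trans ?_ h3
  refine Finset.sum_congr rfl fun A _ => ?_
  rw [← Finset.sum_add_distrib]
  refine Finset.sum_congr rfl fun B _ => ?_
  split_ifs <;> simp

/-- For two independent vectors with parameters c and c', a common success has conditional
probability 1 - (1 - Q(c)Q(c'))^k; the separated pointwise bound is then averaged. -/
theorem sum_mixedTrials_ge {K Q : C → ℝ} (hK : IsWeight K) (hQ0 : ∀ c, 0 ≤ Q c)
    (hQ1 : ∀ c, Q c ≤ 1) (hk : 0 < k) {ρ q : ℝ} (hρ : ∑ c, K c * Q c = ρ)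
    (hq : 1 - ∑ c, K c * (1 - Q c) ^ k = q) :
    2 * q * ρ - ρ ^ 2 - q ^ 2 / k ≤ ∑ A : Fin k → Bool, ∑ B : Fin k → Bool,
      mixedTrials K Q A * mixedTrials K Q B *
        (if ∃ i, A i = true ∧ B i = true then 1 else 0) := by
  have h1 : ∑ A : Fin k → Bool, ∑ B : Fin k → Bool,
      mixedTrials K Q A * mixedTrials K Q B *
        (if ∃ i, A i = true ∧ B i = true then (1 : ℝ) else 0) =
      ∑ c, ∑ c', K c * K c' * (1 - (1 - Q c * Q c') ^ k) := by
    refine Eq.trans ?_ Finset.sum_comm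
    simp only [← sum_trialsWeight_mul_trialsWeight, mixedTrials, Finset.mul_sum,
      Finset.sum_mul]
    rw [Finset.sum_congr rfl fun A _ => Finset.sum_comm, Finset.sum_comm]
    refine Finset.sum_congr rfl fun c _ => ?_
    rw [Finset.sum_congr rfl fun A _ => Finset.sum_comm, Finset.sum_comm]
    refine Finset.sum_congr rfl fun c' _ => Finset.sum_congr rfl fun A _ =>
      Finset.sum_congr rfl fun B _ => ?_
    ring
  have hq' : ∑ c, K c * (1 - (1 - Q c) ^ k) = q := by
    rw [← hq]
    simp only [mul_sub, mul_one, Finset.sum_sub_distrib, hK.sum_eq]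
  rw [h1]
  calc _ = ∑ c, ∑ c', K c * K c' * ((1 - (1 - Q c) ^ k) * Q c' + Q c * (1 - (1 - Q c') ^ k) -
        Q c * Q c' - (1 - (1 - Q c) ^ k) * (1 - (1 - Q c') ^ k) / k) := by
        have e : ∀ u v : C → ℝ, (∑ c, K c * u c) * (∑ c, K c * v c) =
            ∑ c, ∑ c', K c * K c' * (u c * v c') := fun u v => by
          rw [Finset.sum_mul_sum]
          exact Finset.sum_congr rfl fun c _ => Finset.sum_congr rfl fun c' _ => by ring
        have e1 := e (fun c => 1 - (1 - Q c) ^ k) Q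
        have e2 := e Q (fun c => 1 - (1 - Q c) ^ k)
        have e3 := e Q Q
        have e4 := e (fun c => 1 - (1 - Q c) ^ k) (fun c => 1 - (1 - Q c) ^ k)
        rw [hq', hρ] at e1 e2
        rw [hρ] at e3
        rw [hq'] at e4
        simp only [mul_sub, mul_add, ← mul_div_assoc, Finset.sum_sub_distrib,
          Finset.sum_add_distrib, ← Finset.sum_div] at e1 e2 e3 e4 ⊢
        rw [← e1, ← e2, ← e3, ← e4]
        ring
    _ ≤ _ := Finset.sum_le_sum fun c _ => Finset.sum_le_sum fun c' _ =>
        mul_le_mul_of_nonneg_left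
          (one_sub_one_sub_mul_pow_ge (hQ0 c) (hQ1 c) (hQ0 c') (hQ1 c') hk)
          (mul_nonneg (hK.nonneg c) (hK.nonneg c'))

end ConditionallyIndependent

/-! ### Coupled copies of a block factor. -/

section Coupling

open Finset

variable {B σ : Type*} [Fintype B] [DecidableEq B] [Fintype σ] {k : ℕ}

/-- The indicator of a Boolean. -/
def boolInd (b : Bool) : ℝ := if b then 1 else 0

theorem boolInd_nonneg (b : Bool) : 0 ≤ boolInd b := by unfold boolInd; split_ifs <;> simp

theorem boolInd_le_one (b : Bool) : boolInd b ≤ 1 := by unfold boolInd; split_ifs <;> simp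

/-- The weight of a coin with success probability `p`. -/
def coinWeight (p : ℝ) (b : Bool) : ℝ := if b then p else 1 - p

theorem isWeight_coinWeight {p : ℝ} (h0 : 0 ≤ p) (h1 : p ≤ 1) : IsWeight (coinWeight p) :=
  ⟨fun b => by unfold coinWeight; split_ifs <;> linarith, by simp [coinWeight]⟩

/-- The label of `k` coupled copies: a coin, a common label and `k` individual labels. -/
noncomputable def coupledWeight (p : ℝ) (μ : σ → ℝ) (s : Bool × σ × (Fin k → σ)) : ℝ :=
  coinWeight p s.1 * μ s.2.1 * prodWeight (Fin k) μ s.2.2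

/-- The label that the `i`-th copy sees: the coin decides between the common and the individual
label. -/
def copyLabel (i : Fin k) (s : Bool × σ × (Fin k → σ)) : σ := if s.1 then s.2.1 else s.2.2 i

theorem isWeight_coupledWeight {p : ℝ} (h0 : 0 ≤ p) (h1 : p ≤ 1) {μ : σ → ℝ} (hμ : IsWeight μ) :
    IsWeight (coupledWeight (k := k) p μ) := by
  have hp := isWeight_coinWeight h0 h1
  refine ⟨fun s => mul_nonneg (mul_nonneg (hp.nonneg _) (hμ.nonneg _))
    (prodWeight_nonneg hμ.nonneg _), ?_⟩
  simp only [Fintype.sum_prod_type, coupledWeight, ← Finset.mul_sum, hμ.sum_eq,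
    (hμ.prodWeight (V := Fin k)).sum_eq, hp.sum_eq, mul_one]

/-- Whatever the coin shows, the visible label has law μ. So each single copy has the law of the
original process. -/
theorem pushWeight_copyLabel (p : ℝ) {μ : σ → ℝ} (hμ : IsWeight μ) (i : Fin k) :
    pushWeight (coupledWeight p μ) (copyLabel i) = μ := by
  classical
  ext s
  have h1 := pushWeight_prodWeight_eval hμ i s
  rw [pushWeight_eq_sum_mul] at h1 ⊢
  simp only [Fintype.sum_prod_type, Fintype.sum_bool, coupledWeight, copyLabel, coinWeight,
    if_true, Bool.false_eq_true, if_false]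
  have h2 : ∑ x, ∑ y, p * μ x * prodWeight (Fin k) μ y * (if x = s then 1 else 0) = p * μ s := by
    simp only [← Finset.sum_mul, ← Finset.mul_sum, (hμ.prodWeight (V := Fin k)).sum_eq]
    simp
  have h3 : ∑ x, ∑ y : Fin k → σ, (1 - p) * μ x * prodWeight (Fin k) μ y *
      (if y i = s then 1 else 0) = (1 - p) * μ s := by
    simp only [mul_assoc, ← Finset.mul_sum, h1]
    rw [← Finset.sum_mul, hμ.sum_eq, one_mul]
  rw [h2, h3]
  ring

/-- The `k` coupled copies of a Boolean function of the labels. -/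
def copies (f : (B → σ) → Bool) (η : B → Bool × σ × (Fin k → σ)) (i : Fin k) : Bool :=
  f fun w => copyLabel i (η w)

/-- The success probability of a copy given the coins and the common labels. -/
noncomputable def copyProb (μ : σ → ℝ) (f : (B → σ) → Bool) (c : (B → Bool) × (B → σ)) : ℝ :=
  ∑ y, prodWeight B μ y * boolInd (f fun w => if c.1 w then c.2 w else y w)

/-- The weight of the coins and the common labels. -/
noncomputable def commonWeight (p : ℝ) (μ : σ → ℝ) (c : (B → Bool) × (B → σ)) : ℝ :=
  prodWeight B (coinWeight p) c.1 * prodWeight B μ c.2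

theorem isWeight_commonWeight {p : ℝ} (h0 : 0 ≤ p) (h1 : p ≤ 1) {μ : σ → ℝ} (hμ : IsWeight μ) :
    IsWeight (commonWeight (B := B) p μ) := by
  have hp := (isWeight_coinWeight h0 h1).prodWeight (V := B)
  refine ⟨fun s => mul_nonneg (hp.nonneg _) (prodWeight_nonneg hμ.nonneg _), ?_⟩
  simp only [Fintype.sum_prod_type, commonWeight, ← Finset.mul_sum,
    (hμ.prodWeight (V := B)).sum_eq, hp.sum_eq, mul_one]

theorem copyProb_nonneg {μ : σ → ℝ} (hμ : IsWeight μ) (f : (B → σ) → Bool)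
    (c : (B → Bool) × (B → σ)) : 0 ≤ copyProb μ f c :=
  Finset.sum_nonneg fun _ _ => mul_nonneg (prodWeight_nonneg hμ.nonneg _) (boolInd_nonneg _)

theorem copyProb_le_one {μ : σ → ℝ} (hμ : IsWeight μ) (f : (B → σ) → Bool)
    (c : (B → Bool) × (B → σ)) : copyProb μ f c ≤ 1 := by
  rw [← (hμ.prodWeight (V := B)).sum_eq]
  exact Finset.sum_le_sum fun y _ =>
    mul_le_of_le_one_right (prodWeight_nonneg hμ.nonneg _) (boolInd_le_one _)

/-- The coins, the common labels and the individual labels as separate labellings. -/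
def splitLabels : (B → Bool × σ × (Fin k → σ)) ≃ ((B → Bool) × (B → σ)) × (Fin k → B → σ) where
  toFun η := ((fun w => (η w).1, fun w => (η w).2.1), fun i w => (η w).2.2 i)
  invFun q w := (q.1.1 w, q.1.2 w, fun i => q.2 i w)
  left_inv _ := rfl
  right_inv _ := rfl

/-- Given the coins and the common labels, the copies are independent trials. -/
theorem pushWeight_copies (p : ℝ) {μ : σ → ℝ} (hμ : IsWeight μ) (f : (B → σ) → Bool) :
    pushWeight (prodWeight B (coupledWeight p μ)) (copies (k := k) f) =
      mixedTrials (commonWeight p μ) (copyProb μ f) := by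
  classical
  ext A
  rw [pushWeight_eq_sum_mul, ← Equiv.sum_comp (splitLabels (B := B) (σ := σ) (k := k)).symm,
    Fintype.sum_prod_type]
  refine Finset.sum_congr rfl fun c _ => ?_
  have h1 : ∀ y : Fin k → B → σ, prodWeight B (coupledWeight p μ) (splitLabels.symm (c, y)) *
      (if copies f (splitLabels.symm (c, y)) = A then 1 else 0) =
      commonWeight p μ c * ∏ i, prodWeight B μ (y i) *
        (if (f fun w => if c.1 w then c.2 w else y i w) = A i then 1 else 0) := fun y => by
    rw [Finset.prod_mul_distrib, ← mul_assoc]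
    congr 1
    · simp only [prodWeight, coupledWeight, commonWeight, splitLabels, Finset.prod_mul_distrib,
        Equiv.coe_fn_symm_mk]
      rw [Finset.prod_comm]
    · rw [Finset.prod_ite_zero]
      simp only [Finset.prod_const_one, Finset.mem_univ, true_implies, funext_iff]
      rfl
  refine (Finset.sum_congr rfl fun y _ => (Eq.trans (by congr!) (h1 y))).trans ?_
  rw [← Finset.mul_sum, sum_prod_eq_prod_sum fun i y => prodWeight B μ y *
        (if (f fun w => if c.1 w then c.2 w else y w) = A i then 1 else 0), trialsWeight]
  congr 1
  refine Finset.prod_congr rfl fun i _ => ?_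
  have h2 : ∑ y, prodWeight B μ y *
      (if (f fun w => if c.1 w then c.2 w else y w) = true then 1 else 0) = copyProb μ f c := rfl
  cases A i
  · simp only [Bool.false_eq_true, if_false]
    rw [← h2, ← (hμ.prodWeight (V := B)).sum_eq, ← Finset.sum_sub_distrib]
    refine Finset.sum_congr rfl fun y _ => ?_
    cases (f fun w => if c.1 w then c.2 w else y w) <;> simp [(hμ.prodWeight (V := B)).sum_eq]
  · simpa using h2

theorem sum_copies_mul (p : ℝ) {μ : σ → ℝ} (hμ : IsWeight μ) (i : Fin k) (g : (B → σ) → ℝ) :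
    ∑ η, prodWeight B (coupledWeight p μ) η * g (fun w => copyLabel i (η w)) =
      ∑ η, prodWeight B μ η * g η := by
  rw [← sum_pushWeight_mul, pushWeight_prodWeight_map, pushWeight_copyLabel p hμ]

theorem sum_commonWeight_mul_copyProb (p : ℝ) {μ : σ → ℝ} (hμ : IsWeight μ)
    (f : (B → σ) → Bool) :
    ∑ c, commonWeight p μ c * copyProb μ f c = ∑ η, prodWeight B μ η * boolInd (f η) := by
  classical
  have h1 := congrFun (pushWeight_copies (k := 1) p hμ f) fun _ => true
  rw [← sum_copies_mul p hμ (0 : Fin 1) fun η => boolInd (f η)]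
  simp only [mixedTrials, trialsWeight, Fin.prod_univ_one, if_true] at h1
  rw [← h1, pushWeight_eq_sum_mul]
  refine Finset.sum_congr rfl fun η _ => ?_
  have : copies f η = (fun _ : Fin 1 => true) ↔ f (fun w => copyLabel 0 (η w)) = true := by
    rw [funext_iff, Fin.forall_fin_one]
    rfl
  simp [this, boolInd]

/-- The probability that one of `k` copies is successful takes all values between those for
identical and for independent copies. -/
theorem exists_coupling {μ : σ → ℝ} (hμ : IsWeight μ) (f : (B → σ) → Bool) (hk : 0 < k)
    {ρ q : ℝ} (hρ : ∑ η, prodWeight B μ η * boolInd (f η) = ρ) (h1 : ρ ≤ q)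
    (h2 : q ≤ 1 - (1 - ρ) ^ k) :
    ∃ p : ℝ, 0 ≤ p ∧ p ≤ 1 ∧ 1 - ∑ c, commonWeight p μ c * (1 - copyProb μ f c) ^ k = q := by
  classical
  set φ : ℝ → ℝ := fun p => 1 - ∑ c, commonWeight p μ c * (1 - copyProb μ f c) ^ k
  have hφ : Continuous φ := by
    refine continuous_const.sub (continuous_finsetSum _ fun c _ =>
      Continuous.mul (Continuous.mul (continuous_finsetProd _ fun w _ => ?_) continuous_const)
        continuous_const)
    unfold coinWeight
    split_ifs <;> fun_prop
  -- At p = 0 and p = 1 the coins are deterministic: copies are then independent or identical. The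
  -- values between follow by continuity.
  have hval : ∀ (b : Bool) (p : ℝ), p = (if b then 1 else 0) → ∀ g : (B → Bool) × (B → σ) → ℝ,
      ∑ c, commonWeight p μ c * g c = ∑ x, prodWeight B μ x * g (fun _ => b, x) := by
    intro b p hp g
    rw [Fintype.sum_prod_type, Finset.sum_eq_single fun _ => b]
    · refine Finset.sum_congr rfl fun x _ => ?_
      cases b <;> simp [commonWeight, prodWeight, coinWeight, hp]
    · intro c _ hc
      obtain ⟨w, hw⟩ := Function.ne_iff.1 hc
      refine Finset.sum_eq_zero fun x _ => ?_
      have : prodWeight B (coinWeight p) c = 0 := Finset.prod_eq_zero (Finset.mem_univ w) (by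
        cases b <;> cases h : c w <;> simp_all [coinWeight])
      simp [commonWeight, this]
    · simp
  have hφ0 : φ 0 = 1 - (1 - ρ) ^ k := by
    simp only [φ]
    rw [hval false 0 (by simp)]
    have : ∀ x, copyProb μ f ((fun _ => false), x) = ρ := fun x => by
      simp [copyProb, ← hρ]
    simp only [this]
    rw [← Finset.sum_mul, (hμ.prodWeight (V := B)).sum_eq, one_mul]
  have hφ1 : φ 1 = ρ := by
    simp only [φ]
    rw [hval true 1 (by simp)]
    have : ∀ x, copyProb μ f ((fun _ => true), x) = boolInd (f x) := fun x => by
      simp only [copyProb, if_true]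
      rw [← Finset.sum_mul, (hμ.prodWeight (V := B)).sum_eq, one_mul]
    simp only [this]
    have h : ∀ b, (1 - boolInd b) ^ k = 1 - boolInd b := fun b => by
      cases b <;> simp [boolInd, hk.ne']
    simp only [h, mul_sub, mul_one, Finset.sum_sub_distrib, (hμ.prodWeight (V := B)).sum_eq, hρ]
    ring
  obtain ⟨p, hp, hpq⟩ := intermediate_value_Icc' zero_le_one hφ.continuousOn
    (show q ∈ Set.Icc (φ 1) (φ 0) by rw [hφ0, hφ1]; exact ⟨h1, h2⟩)
  exact ⟨p, hp.1, hp.2, hpq⟩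

end Coupling

/-! ### The entropy inequality for coupled copies. -/

namespace RegularTree

open Finset

variable {d : ℕ}

/-- The entropy inequality for `k` coupled copies of a percolation process that is a block factor
of independent labels. -/
theorem density_entropy_le {σ : Type*} [Fintype σ] {μ : σ → ℝ} (hμ : IsWeight μ) {r : ℕ}
    (f : (Ball d r → σ) → Bool) {k : ℕ} (hk : 0 < k) {ρ J δ q : ℝ} (hρ0 : 0 < ρ) (hδ0 : 0 < δ)
    (hδ1 : δ ≤ 1) (hρ : ∑ η, prodWeight (Ball d r) μ η * boolInd (f η) = ρ)
    (hJ : ∑ a, ∑ η, prodWeight (Ball d (r + 1)) μ η *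
      boolInd (f (fun u => η u.incl) && f fun u => η (u.translate a)) ≤ J)
    (h1 : ρ ≤ q) (h2 : q ≤ 1 - (1 - ρ) ^ k) :
    d * ((1 - δ) * (2 * q * ρ - ρ ^ 2 - q ^ 2 / k)) + Real.log δ * (k * J) ≤
      2 * (q * (1 + k * Real.log 2 + Real.log (1 / ρ))) := by
  classical
  obtain ⟨p, hp0, hp1, hpq⟩ := exists_coupling hμ f hk hρ h1 h2
  set μ' := coupledWeight (k := k) p μ
  have hμ' : IsWeight μ' := isWeight_coupledWeight hp0 hp1 hμ
  set F := copies (k := k) f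
  have hlaw : pushWeight (prodWeight (Ball d r) μ') F =
      mixedTrials (commonWeight p μ) (copyProb μ f) := pushWeight_copies p hμ f
  have hincl : Function.Injective (Ball.incl : Ball d r → Ball d (r + 1)) := fun u v h =>
    Subtype.ext (congrArg (fun w : Ball d (r + 1) => w.1) h)
  have htr : ∀ a, Function.Injective (Ball.translate a : Ball d r → Ball d (r + 1)) :=
    fun a u v h => Subtype.ext <| (shiftIso a).injective
      (congrArg (fun w : Ball d (r + 1) => w.1) h)
  have hA : pushWeight (prodWeight (Ball d (r + 1)) μ') (fun η => F fun u => η u.incl) =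
      pushWeight (prodWeight (Ball d r) μ') F := by
    rw [← pushWeight_prodWeight_comp hμ' hincl, pushWeight_pushWeight]
  have hB : ∀ a, pushWeight (prodWeight (Ball d (r + 1)) μ')
      (fun η => F fun u => η (u.translate a)) = pushWeight (prodWeight (Ball d r) μ') F :=
    fun a => by rw [← pushWeight_prodWeight_comp hμ' (htr a), pushWeight_pushWeight]
  have hAe : varEntropy (prodWeight (Ball d (r + 1)) μ') (fun η => F fun u => η u.incl) =
      varEntropy (prodWeight (Ball d r) μ') F := congrArg weightEntropy hA
  have hBe : ∀ a, varEntropy (prodWeight (Ball d (r + 1)) μ')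
      (fun η => F fun u => η (u.translate a)) = varEntropy (prodWeight (Ball d r) μ') F :=
    fun a => congrArg weightEntropy (hB a)
  have hν := sum_mixedTrials_ge (isWeight_commonWeight hp0 hp1 hμ) (copyProb_nonneg hμ f)
    (copyProb_le_one hμ f) hk ((sum_commonWeight_mul_copyProb p hμ f).trans hρ) hpq
  -- Union bound over the k copies, each of which has the edge probability of the original process.
  have hevent : ∀ a, ∑ η, prodWeight (Ball d (r + 1)) μ' η *
      (if ∃ i, F (fun u => η u.incl) i = true ∧ F (fun u => η (u.translate a)) i = true
        then 1 else 0) ≤ k * ∑ η, prodWeight (Ball d (r + 1)) μ η *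
      boolInd (f (fun u => η u.incl) && f fun u => η (u.translate a)) := fun a => by
    calc _ ≤ ∑ η, ∑ i : Fin k, prodWeight (Ball d (r + 1)) μ' η *
          boolInd (f (fun u => copyLabel i (η u.incl)) &&
            f fun u => copyLabel i (η (u.translate a))) := by
          refine Finset.sum_le_sum fun η _ => ?_
          rw [← Finset.mul_sum]
          refine mul_le_mul_of_nonneg_left ?_ (prodWeight_nonneg hμ'.nonneg _)
          split_ifs with h
          · obtain ⟨i, hi1, hi2⟩ := h
            refine le_trans (le_of_eq ?_) (Finset.single_le_sum
              (f := fun i => boolInd (f (fun u => copyLabel i (η u.incl)) &&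
                f fun u => copyLabel i (η (u.translate a))))
              (fun i _ => boolInd_nonneg _) (Finset.mem_univ i))
            have hi1' : f (fun u => copyLabel i (η u.incl)) = true := hi1
            have hi2' : f (fun u => copyLabel i (η (u.translate a))) = true := hi2
            simp [boolInd, hi1', hi2']
          · exact Finset.sum_nonneg fun i _ => boolInd_nonneg _
      _ = ∑ i : Fin k, ∑ η, prodWeight (Ball d (r + 1)) μ η *
          boolInd (f (fun u => η u.incl) && f fun u => η (u.translate a)) := by
          rw [Finset.sum_comm]
          exact Finset.sum_congr rfl fun i _ => sum_copies_mul p hμ i fun η =>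
            boolInd (f (fun u => η u.incl) && f fun u => η (u.translate a))
      _ = _ := by simp
  have hedge : ∀ a, (1 - δ) * (2 * q * ρ - ρ ^ 2 - q ^ 2 / k) + Real.log δ *
      (k * ∑ η, prodWeight (Ball d (r + 1)) μ η *
        boolInd (f (fun u => η u.incl) && f fun u => η (u.translate a))) ≤
      2 * varEntropy (prodWeight (Ball d r) μ') F - varEntropy (prodWeight (Ball d (r + 1)) μ')
        (fun η => (F fun u => η u.incl, F fun u => η (u.translate a))) := fun a => by
    have h3 := le_mutualInfo (hμ'.prodWeight (V := Ball d (r + 1))) (fun η => F fun u => η u.incl)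
      (fun η => F fun u => η (u.translate a)) (fun A B => ∃ i, A i = true ∧ B i = true) hδ0
    rw [hA, hB a, hAe, hBe a, hlaw] at h3
    have h4 := mul_le_mul_of_nonneg_left hν (sub_nonneg.2 hδ1)
    have h5 := mul_le_mul_of_nonpos_left (hevent a) (Real.log_nonpos hδ0.le hδ1)
    refine le_trans (add_le_add ?_ ?_) (h3.trans (le_of_eq (by ring)))
    · refine h4.trans (le_of_eq ?_)
      congr!
    · refine h5.trans (le_of_eq ?_)
      congr!
  -- Summed over the d edges, the mutual informations are at most 2dH - 2(d-1)H = 2H by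
  -- `edge_vertex_entropy`.
  have hsum := Finset.sum_le_sum fun a (_ : a ∈ (univ : Finset (Fin d))) => hedge a
  rw [Finset.sum_sub_distrib, Finset.sum_add_distrib, ← Finset.mul_sum, ← Finset.mul_sum,
    ← Finset.mul_sum] at hsum
  simp only [Finset.sum_const, Finset.card_univ, Fintype.card_fin, nsmul_eq_mul] at hsum
  have hev := edge_vertex_entropy hμ' F
  have hJ' : Real.log δ * (k * J) ≤ Real.log δ * (k * ∑ a, ∑ η, prodWeight (Ball d (r + 1)) μ η *
      boolInd (f (fun u => η u.incl) && f fun u => η (u.translate a))) :=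
    mul_le_mul_of_nonpos_left (mul_le_mul_of_nonneg_left hJ (Nat.cast_nonneg k))
      (Real.log_nonpos hδ0.le hδ1)
  have hH : varEntropy (prodWeight (Ball d r) μ') F ≤
      q * (1 + k * Real.log 2 + Real.log (1 / ρ)) := by
    have h0 : 1 - pushWeight (prodWeight (Ball d r) μ') F (fun _ => false) = q := by
      rw [hlaw, mixedTrials_false, hpq]
    have h3 := weightEntropy_le ((hμ'.prodWeight (V := Ball d r)).push F) (fun _ => false) hρ0
      (h0 ▸ h1)
    rw [h0] at h3
    refine h3.trans (le_of_eq ?_)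
    simp
  linarith

end RegularTree

/-! ### The choice of parameters. -/

section Asymptotics

open Real

theorem mul_div_two_le_one_sub_pow {ρ : ℝ} (h0 : 0 ≤ ρ) (h1 : ρ ≤ 1) {k : ℕ} (hk : k * ρ ≤ 1) :
    k * ρ / 2 ≤ 1 - (1 - ρ) ^ k := by
  have h2 : (1 - ρ) ^ k * (1 + k * ρ) ≤ 1 := by
    calc (1 - ρ) ^ k * (1 + k * ρ) ≤ (1 - ρ) ^ k * (1 + ρ) ^ k :=
          mul_le_mul_of_nonneg_left (one_add_mul_le_pow (by linarith) k)
            (pow_nonneg (sub_nonneg.2 h1) k)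
      _ = (1 - ρ ^ 2) ^ k := by rw [← mul_pow]; ring
      _ ≤ 1 := pow_le_one₀ (by nlinarith) (by nlinarith [sq_nonneg ρ])
  have h3 : 0 ≤ k * ρ := mul_nonneg (Nat.cast_nonneg k) h0
  nlinarith

/-- The case q = ρ of identical copies. It yields the crude bound dρ ≤ 8(1 + m² + l), which shows
that ρ is small enough for q = mρ to be attainable. -/
theorem sq_mul_le_one_of_entropy_bound {m d ρ L ε l : ℝ} (hm : 10 < m)
    (hεL : m ^ 2 * ε * L ≤ 1 / 4) (hd : 0 < d) (hρ : 0 < ρ) (hdl : 8 * m ^ 2 * (1 + m ^ 2 + l) ≤ d)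
    (h : d * ((1 - 1 / m) * (2 * ρ * ρ - ρ ^ 2 - ρ ^ 2 / m ^ 2)) + -L * (m ^ 2 * (d * (ε * ρ ^ 2))) ≤
      2 * (ρ * (1 + m ^ 2 + l))) : m ^ 2 * ρ ≤ 1 := by
  have hm0 : 0 < m := by linarith
  have h1 : d * ((1 - 1 / m) * (2 * ρ * ρ - ρ ^ 2 - ρ ^ 2 / m ^ 2)) +
      -L * (m ^ 2 * (d * (ε * ρ ^ 2))) =
      ρ * (d * ρ * ((1 - 1 / m) * (1 - (1 / m) ^ 2) - m ^ 2 * ε * L)) := by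
    rw [one_div_pow]
    ring
  rw [h1, mul_left_comm 2] at h
  have h2 := le_of_mul_le_mul_left h hρ
  have h3 : 1 / m ≤ 1 / 10 := one_div_le_one_div_of_le (by norm_num) hm.le
  have h4 : 0 < 1 / m := by positivity
  set t := 1 / m
  have h5 : 1 / 2 ≤ (1 - t) * (1 - t ^ 2) := by nlinarith
  have h6 := mul_le_mul_of_nonneg_left (show 1 / 4 ≤ (1 - t) * (1 - t ^ 2) - m ^ 2 * ε * L by
    linarith) (mul_pos hd hρ).le
  have h7 := mul_le_mul_of_nonneg_left (h6.trans h2) (sq_nonneg m)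
  have h8 : d * (m ^ 2 * ρ) ≤ d * 1 := by linarith
  exact le_of_mul_le_mul_left h8 hd

/-- The case q = mρ, k = m², δ = 1/m. The main terms give (2m-5)αl ≤ 2m(1 + m² + l), and 5α < m(α-1)
turns the left factor into more than m(α+1), impossible for large l. -/
theorem false_of_entropy_bound {α m d ρ L ε l : ℝ} (hα : 1 < α) (hm : 10 < m)
    (hmα : 5 * α < m * (α - 1)) (hεL : m ^ 2 * ε * L ≤ 1 / 4) (hd : 0 < d) (hρ : 0 < ρ)
    (hdρ : α * l ≤ d * ρ) (hl : 0 < l) (hl' : 2 * (1 + m ^ 2) / (α - 1) < l)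
    (h : d * ((1 - 1 / m) * (2 * (m * ρ) * ρ - ρ ^ 2 - (m * ρ) ^ 2 / m ^ 2)) +
      -L * (m ^ 2 * (d * (ε * ρ ^ 2))) ≤ 2 * (m * ρ * (1 + m ^ 2 + l))) : False := by
  have hm0 : 0 < m := by linarith
  have h1 : d * ((1 - 1 / m) * (2 * (m * ρ) * ρ - ρ ^ 2 - (m * ρ) ^ 2 / m ^ 2)) +
      -L * (m ^ 2 * (d * (ε * ρ ^ 2))) =
      ρ * (d * ρ * ((1 - 1 / m) * (2 * m - 2) - m ^ 2 * ε * L)) := by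
    rw [mul_pow, mul_div_cancel_left₀ _ (pow_ne_zero 2 hm0.ne')]
    ring
  rw [h1, mul_assoc m, mul_left_comm m, mul_left_comm 2] at h
  have h2 := le_of_mul_le_mul_left h hρ
  have h3 : (1 - 1 / m) * (2 * m - 2) = 2 * m - 4 + 2 * (1 / m) := by
    field_simp
    ring
  have h4 : 0 < 1 / m := by positivity
  have h5 := mul_le_mul_of_nonneg_left (show 2 * m - 5 ≤ (1 - 1 / m) * (2 * m - 2) -
    m ^ 2 * ε * L by rw [h3]; linarith) (mul_pos hd hρ).le
  have h6 := mul_le_mul_of_nonneg_right hdρ (show 0 ≤ 2 * m - 5 by linarith)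
  have h7 := mul_lt_mul_of_pos_right hmα hl
  have h8 : m * ((α + 1) * l) ≤ m * (2 * (1 + m ^ 2 + l)) := by
    linarith [h5.trans h2]
  have h9 := le_of_mul_le_mul_left h8 hm0
  rw [div_lt_iff₀ (by linarith)] at hl'
  linarith

/-- The entropy inequality for many copies forces densities above `(log d) / d` to come with many
occupied edges. -/
theorem eventually_not_entropy_bound {α : ℝ} (hα : 1 < α) :
    ∃ ε : ℝ, 0 < ε ∧ ∀ᶠ d : ℕ in atTop, ∀ ρ : ℝ, 0 < ρ → ρ ≤ 1 → α * (log d / d) ≤ ρ →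
      ¬ ∀ (k : ℕ) (δ q : ℝ), 0 < k → 0 < δ → δ ≤ 1 → ρ ≤ q → q ≤ 1 - (1 - ρ) ^ k →
        d * ((1 - δ) * (2 * q * ρ - ρ ^ 2 - q ^ 2 / k)) + log δ * (k * (d * (ε * ρ ^ 2))) ≤
          2 * (q * (1 + k * log 2 + log (1 / ρ))) := by
  obtain ⟨m, hm⟩ := exists_nat_gt (max 10 (5 * α / (α - 1)))
  have hm10 : (10 : ℝ) < m := (le_max_left _ _).trans_lt hm
  have hmα : 5 * α < m * (α - 1) := by
    rw [← div_lt_iff₀ (by linarith)]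
    exact (le_max_right _ _).trans_lt hm
  have hm0 : (0 : ℝ) < m := by linarith
  set L : ℝ := log m
  have hL : 0 ≤ L := log_nonneg (by linarith)
  -- Small enough that the true probability of the event, weighted by log(1/δ) = log m, costs at
  -- most 1/4 in the main coefficient.
  set ε : ℝ := 1 / (4 * m ^ 2 * (L + 1)) with hεdef
  have hε : 0 < ε := by positivity
  have hεL : m ^ 2 * ε * L ≤ 1 / 4 := by
    rw [hεdef]
    have : (m : ℝ) ^ 2 * (1 / (4 * m ^ 2 * (L + 1))) * L = L / (4 * (L + 1)) := by
      field_simp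
    rw [this, div_le_iff₀ (by linarith)]
    linarith
  have hlog : Tendsto (fun d : ℕ => log d) atTop atTop :=
    tendsto_log_atTop.comp tendsto_natCast_atTop_atTop
  have hlittle : ∀ᶠ d : ℕ in atTop, 8 * (m : ℝ) ^ 2 * (1 + m ^ 2 + log d) ≤ d := by
    have h1 := (isLittleO_log_id_atTop.comp_tendsto tendsto_natCast_atTop_atTop).def
      (show (0 : ℝ) < 1 / (16 * m ^ 2) by positivity)
    have h2 := tendsto_natCast_atTop_atTop (R := ℝ) |>.eventually_ge_atTop
      (16 * m ^ 2 * (1 + (m : ℝ) ^ 2))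
    filter_upwards [h1, h2] with d h1 h2
    simp only [Function.comp, id, norm_natCast] at h1
    have h3 := (le_abs_self _).trans h1
    rw [one_div, inv_mul_eq_div, le_div_iff₀ (by positivity)] at h3
    linarith
  refine ⟨ε, hε, ?_⟩
  filter_upwards [hlittle, hlog.eventually_ge_atTop 1,
    hlog.eventually_gt_atTop (2 * (1 + m ^ 2) / (α - 1)), eventually_gt_atTop 0]
    with d hd1 hd2 hd3 hd0 ρ hρ0 hρ1 hρ H
  have hd0' : (0 : ℝ) < d := by exact_mod_cast hd0
  have hm1 : 0 < m := by exact_mod_cast hm0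
  have hdρ : α * log d ≤ d * ρ := by
    rw [← mul_div_assoc, div_le_iff₀ hd0'] at hρ
    linarith
  -- From dρ ≥ α log d ≥ 1.
  have hlogρ : log (1 / ρ) ≤ log d := by
    refine log_le_log (by positivity) ?_
    rw [div_le_iff₀ hρ0]
    nlinarith
  have hlog2 : log 2 ≤ 1 := by linarith [log_two_lt_d9]
  have hδL : log (1 / (m : ℝ)) = -L := by rw [one_div, log_inv]
  have hδ1 : 1 / (m : ℝ) ≤ 1 := by
    rw [div_le_one hm0]
    linarith
  have hδ0 : 0 < 1 / (m : ℝ) := by positivity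
  have hrhs : 1 + ((m ^ 2 : ℕ) : ℝ) * log 2 + log (1 / ρ) ≤ 1 + m ^ 2 + log d := by
    push_cast
    have := mul_le_mul_of_nonneg_left hlog2 (sq_nonneg (m : ℝ))
    linarith
  have hbound : ∀ q : ℝ, 0 < q → ρ ≤ q → q ≤ 1 - (1 - ρ) ^ (m ^ 2) →
      d * ((1 - 1 / (m : ℝ)) * (2 * q * ρ - ρ ^ 2 - q ^ 2 / (m : ℝ) ^ 2)) +
        -L * ((m : ℝ) ^ 2 * (d * (ε * ρ ^ 2))) ≤ 2 * (q * (1 + (m : ℝ) ^ 2 + log d)) := by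
    intro q hq0 hq hq'
    have h1 := (H (m ^ 2) (1 / m) q (by positivity) hδ0 hδ1 hq hq').trans
      (mul_le_mul_of_nonneg_left (mul_le_mul_of_nonneg_left hrhs hq0.le) zero_le_two)
    rw [hδL] at h1
    push_cast at h1
    exact h1
  have hsmall : (m : ℝ) ^ 2 * ρ ≤ 1 :=
    sq_mul_le_one_of_entropy_bound hm10 hεL hd0' hρ0 hd1 (hbound ρ hρ0 le_rfl (by
      have := pow_le_of_le_one (sub_nonneg.2 hρ1) (by linarith : 1 - ρ ≤ 1)
        (show m ^ 2 ≠ 0 by positivity)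
      linarith))
  refine false_of_entropy_bound hα hm10 hmα hεL hd0' hρ0 hdρ (by linarith) hd3
    (hbound (m * ρ) (mul_pos hm0 hρ0) (le_mul_of_one_le_left hρ0.le (by linarith)) ?_)
  refine le_trans ?_ (mul_div_two_le_one_sub_pow hρ0.le hρ1 (k := m ^ 2) (by push_cast; exact hsmall))
  push_cast
  have h2 : (2 : ℝ) * m ≤ m ^ 2 := by nlinarith
  linarith [mul_le_mul_of_nonneg_right h2 hρ0.le]

end Asymptotics

/-! ### Uniform labels and their finite digitizations. -/

section RandomLabels

variable {V : Type*}

/-- The law of independent labels that are uniform on the unit interval. -/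
noncomputable def labelMeasure (V : Type*) : Measure (V → unitInterval) :=
  Measure.infinitePi fun _ : V => (volume : Measure unitInterval)

instance : IsProbabilityMeasure (labelMeasure V) := by
  unfold labelMeasure
  infer_instance

theorem measurable_relabel {G : SimpleGraph V} (γ : G ≃g G) :
    Measurable (relabel γ : (V → unitInterval) → V → unitInterval) :=
  measurable_pi_lambda _ fun v => measurable_pi_apply (γ.symm v)

theorem measurePreserving_relabel {G : SimpleGraph V} (γ : G ≃g G) :
    MeasurePreserving (relabel γ) (labelMeasure V) (labelMeasure V) := by
  classical
  refine ⟨measurable_relabel γ, Measure.eq_infinitePi _ fun s t ht => ?_⟩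
  rw [Measure.map_apply (measurable_relabel γ) (.pi s.countable_toSet fun i _ => ht i)]
  have h1 : relabel γ ⁻¹' (s : Set V).pi t =
      ((s.image γ.symm : Finset V) : Set V).pi fun i => t (γ i) := by
    ext ω
    simp [relabel, Set.mem_pi]
  rw [h1, labelMeasure, Measure.infinitePi_pi _ fun i _ => ht _,
    Finset.prod_image γ.symm.injective.injOn]
  simp

theorem IsRandomLabelling.map_eq {Ω : Type*} [MeasurableSpace Ω] {P : Measure Ω}
    [IsProbabilityMeasure P] {X : V → Ω → unitInterval} (hX : IsRandomLabelling P X) :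
    P.map (fun x v => X v x) = labelMeasure V := by
  rw [hX.indep.map_fun_eq_infinitePi_map hX.measurable, labelMeasure]
  simp only [hX.uniform]

open Classical in
/-- The membership of a label in the first `n` sets of a generating sequence. -/
noncomputable def labelDigits (n : ℕ) (t : unitInterval) (i : Fin n) : Bool :=
  decide (t ∈ MeasurableSpace.natGeneratingSequence unitInterval i)

theorem measurable_labelDigits (n : ℕ) : Measurable (labelDigits n) := by
  refine measurable_pi_lambda _ fun i => measurable_to_bool ?_
  convert MeasurableSpace.measurableSet_natGeneratingSequence (α := unitInterval) i using 1
  ext t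
  simp [labelDigits]

/-- The law of the digits of a uniform label. -/
noncomputable def digitsWeight (n : ℕ) (s : Fin n → Bool) : ℝ :=
  (volume : Measure unitInterval).real (labelDigits n ⁻¹' {s})

theorem isWeight_digitsWeight (n : ℕ) : IsWeight (digitsWeight n) := by
  refine ⟨fun s => measureReal_nonneg, ?_⟩
  simp only [digitsWeight]
  rw [sum_measureReal_preimage_singleton _ fun s _ =>
    measurable_labelDigits n (measurableSet_singleton s)]
  simp

end RandomLabels

/-! ### From block factors to measurable events. -/

namespace RegularTree

variable {d : ℕ}

/-- The digits of the labels in a ball. -/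
noncomputable def ballDigits (r n : ℕ) (ω : Vertex d → unitInterval) (u : Ball d r) :
    Fin n → Bool := labelDigits n (ω u.1)

theorem measurable_ballDigits (r n : ℕ) : Measurable (ballDigits (d := d) r n) :=
  measurable_pi_lambda _ fun u => (measurable_labelDigits n).comp (measurable_pi_apply u.1)

theorem labelMeasure_ballDigits (r n : ℕ) (η : Ball d r → Fin n → Bool) :
    (labelMeasure (Vertex d)).real (ballDigits r n ⁻¹' {η}) =
      prodWeight (Ball d r) (digitsWeight n) η := by
  classical
  set s : Finset (Vertex d) := Finset.univ.image (Subtype.val : Ball d r → Vertex d)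
  set t : Vertex d → Set unitInterval := fun v =>
    if h : v.1.length ≤ r then labelDigits n ⁻¹' {η ⟨v, h⟩} else Set.univ
  have ht : ∀ v, MeasurableSet (t v) := fun v => by
    simp only [t]
    split_ifs
    · exact measurable_labelDigits n (measurableSet_singleton _)
    · exact MeasurableSet.univ
  have htu : ∀ u : Ball d r, t u.1 = labelDigits n ⁻¹' {η u} := fun u => by
    simp [t, u.2]
  have h1 : ballDigits r n ⁻¹' {η} = (s : Set (Vertex d)).pi t := by
    ext ω
    simp only [Set.mem_preimage, Set.mem_singleton_iff, funext_iff (f := ballDigits r n ω),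
      Set.mem_pi, Finset.mem_coe, s, Finset.mem_image, Finset.mem_univ, true_and]
    constructor
    · rintro h _ ⟨u, rfl⟩
      rw [htu]
      exact h u
    · intro h u
      have := h u.1 ⟨u, rfl⟩
      rwa [htu] at this
  rw [h1, measureReal_def, labelMeasure, Measure.infinitePi_pi _ fun i _ => ht i,
    Finset.prod_image Subtype.val_injective.injOn, ENNReal.toReal_prod]
  exact Finset.prod_congr rfl fun u _ => by rw [htu]; rfl

theorem sum_prodWeight_boolInd (r n : ℕ) (G : (Ball d r → Fin n → Bool) → Bool) :
    ∑ η, prodWeight (Ball d r) (digitsWeight n) η * boolInd (G η) =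
      (labelMeasure (Vertex d)).real {ω | G (ballDigits r n ω) = true} := by
  classical
  have h1 : {ω : Vertex d → unitInterval | G (ballDigits r n ω) = true} =
      ballDigits r n ⁻¹' ((Finset.univ.filter fun η => G η = true : Finset _) : Set _) := by
    ext ω
    simp
  rw [h1, ← sum_measureReal_preimage_singleton _ fun η _ =>
    measurable_ballDigits r n (measurableSet_singleton η), Finset.sum_filter]
  exact Finset.sum_congr rfl fun η _ => by rw [labelMeasure_ballDigits]; simp [boolInd]

/-- The events that depend on finitely many digits of finitely many labels. -/
def digitEvents (d : ℕ) : Set (Set (Vertex d → unitInterval)) :=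
  {s | ∃ (n : ℕ) (g : (Ball d n → Fin n → Bool) → Bool), s = {ω | g (ballDigits n n ω) = true}}

theorem isSetAlgebra_digitEvents : IsSetAlgebra (digitEvents d) where
  empty_mem := ⟨0, fun _ => false, by simp⟩
  compl_mem := by
    rintro _ ⟨n, g, rfl⟩
    exact ⟨n, fun η => !g η, by ext; simp⟩
  union_mem := by
    rintro _ _ ⟨n, g, rfl⟩ ⟨m, h, rfl⟩
    refine ⟨max n m, fun η =>
      g (fun u i => η ⟨u.1, u.2.trans (le_max_left n m)⟩ (i.castLE (le_max_left n m))) ||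
      h (fun u i => η ⟨u.1, u.2.trans (le_max_right n m)⟩ (i.castLE (le_max_right n m))), ?_⟩
    ext ω
    exact (Bool.or_eq_true _ _).symm.to_iff

theorem generateFrom_digitEvents :
    (MeasurableSpace.pi : MeasurableSpace (Vertex d → unitInterval)) =
      MeasurableSpace.generateFrom (digitEvents d) := by
  refine le_antisymm (iSup_le fun v => ?_) (MeasurableSpace.generateFrom_le ?_)
  · rw [← MeasurableSpace.generateFrom_natGeneratingSequence unitInterval,
      MeasurableSpace.comap_generateFrom]
    refine MeasurableSpace.generateFrom_mono ?_
    rintro _ ⟨_, ⟨i, rfl⟩, rfl⟩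
    refine ⟨max v.1.length (i + 1), fun η => η ⟨v, le_max_left _ _⟩
      ⟨i, (Nat.lt_succ_self i).trans_le (le_max_right _ _)⟩, ?_⟩
    ext ω
    simp [ballDigits, labelDigits]
  · rintro _ ⟨n, g, rfl⟩
    exact measurable_ballDigits n n ((Set.toFinite {η | g η = true}).measurableSet)

/-- The digit events form an algebra that generates the product σ-algebra, hence they are dense in
measure. They are block factors over a finite alphabet, to which the entropy inequality applies. -/
theorem exists_digitEvent_approx {A : Set (Vertex d → unitInterval)} (hA : MeasurableSet A)
    {τ : ℝ} (hτ : 0 < τ) : ∃ B ∈ digitEvents d, (labelMeasure (Vertex d)).real (symmDiff A B) < τ := by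
  obtain ⟨B, hB, h⟩ := (Measure.MeasureDense.of_generateFrom_isSetAlgebra_finite
    (labelMeasure (Vertex d)) isSetAlgebra_digitEvents generateFrom_digitEvents).approx A hA
      (measure_ne_top _ _) τ hτ
  exact ⟨B, hB, (ENNReal.lt_ofReal_iff_toReal_lt (measure_ne_top _ _)).1 h⟩

theorem measureReal_le_add_symmDiff {Ω : Type*} [MeasurableSpace Ω] (P : Measure Ω)
    [IsFiniteMeasure P] (A B : Set Ω) : P.real A ≤ P.real B + P.real (symmDiff A B) := by
  refine (measureReal_mono (fun x hx => ?_)).trans (measureReal_union_le B (symmDiff A B))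
  by_cases h : x ∈ B
  · exact Or.inl h
  · exact Or.inr (Or.inl ⟨hx, h⟩)

/-- An event of density above `(log d) / d` is often seen from both ends of an edge. -/
theorem exists_edge_density_lower_bound {α : ℝ} (hα : 1 < α) :
    ∃ ε : ℝ, 0 < ε ∧ ∀ᶠ d : ℕ in atTop, ∀ A : Set (Vertex d → unitInterval), MeasurableSet A →
      0 < (labelMeasure (Vertex d)).real A →
      α * (Real.log d / d) ≤ (labelMeasure (Vertex d)).real A →
      d * (ε * (labelMeasure (Vertex d)).real A ^ 2) <
        ∑ a, (labelMeasure (Vertex d)).real (A ∩ relabel (shiftIso a) ⁻¹' A) := by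
  obtain ⟨ε, hε, h⟩ := eventually_not_entropy_bound (show 1 < (1 + α) / 2 by linarith)
  refine ⟨ε / 4, by positivity, ?_⟩
  filter_upwards [h, eventually_gt_atTop 0] with d hd hd0 A hA hρ0 hρ
  set M := labelMeasure (Vertex d)
  set ρ := M.real A
  by_contra! hJ
  have hd0' : (0 : ℝ) < d := by exact_mod_cast hd0
  -- The first two bounds let ε replace ε/4 for the approximating event; the third keeps its density
  -- above (1+α)/2 times (log d)/d.
  obtain ⟨τ, hτ0, hτ1, hτ2, hτ3⟩ : ∃ τ : ℝ, 0 < τ ∧ τ ≤ ρ / 4 ∧ τ ≤ ε * ρ ^ 2 / 8 ∧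
      τ ≤ ρ * (1 - (1 + α) / 2 / α) := by
    have h1 : 0 < 1 - (1 + α) / 2 / α := by
      rw [sub_pos, div_lt_one (by linarith)]
      linarith
    exact ⟨min (min (ρ / 4) (ε * ρ ^ 2 / 8)) (ρ * (1 - (1 + α) / 2 / α)), by positivity,
      (min_le_left _ _).trans (min_le_left _ _), (min_le_left _ _).trans (min_le_right _ _),
      min_le_right _ _⟩
  obtain ⟨B, ⟨n, g, rfl⟩, hB⟩ := exists_digitEvent_approx hA hτ0
  set B : Set (Vertex d → unitInterval) := {ω | g (ballDigits n n ω) = true}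
  have hBm : MeasurableSet B :=
    measurable_ballDigits n n ((Set.toFinite {η | g η = true}).measurableSet)
  set ρ' := M.real B
  have h1 : ρ ≤ ρ' + τ := (measureReal_le_add_symmDiff M A B).trans (by linarith)
  have hρ' : (1 + α) / 2 * (Real.log d / d) ≤ ρ' := by
    have h2 : (1 + α) / 2 * (Real.log d / d) = (1 + α) / 2 / α * (α * (Real.log d / d)) := by
      field_simp
    rw [h2]
    have h3 : 0 ≤ (1 + α) / 2 / α := by positivity
    have := mul_le_mul_of_nonneg_left hρ h3
    linarith
  have hedge : ∀ a, M.real (B ∩ relabel (shiftIso a) ⁻¹' B) ≤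
      M.real (A ∩ relabel (shiftIso a) ⁻¹' A) + 2 * τ := fun a => by
    have h3 := measureReal_le_add_symmDiff M (B ∩ relabel (shiftIso a) ⁻¹' B)
      (A ∩ relabel (shiftIso a) ⁻¹' A)
    have h4 : symmDiff (B ∩ relabel (shiftIso a) ⁻¹' B) (A ∩ relabel (shiftIso a) ⁻¹' A) ⊆
        symmDiff A B ∪ relabel (shiftIso a) ⁻¹' symmDiff A B := by
      intro ω
      simp only [Set.mem_symmDiff, Set.mem_inter_iff, Set.mem_preimage, Set.mem_union]
      tauto
    have h5 := (measureReal_mono h4 (measure_ne_top M _)).trans (measureReal_union_le _ _)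
    rw [(measurePreserving_relabel (shiftIso a)).measureReal_preimage
      (hA.symmDiff hBm).nullMeasurableSet] at h5
    linarith
  have hsum : ∑ a, M.real (B ∩ relabel (shiftIso a) ⁻¹' B) ≤ d * (ε * ρ' ^ 2) := by
    calc _ ≤ ∑ a, (M.real (A ∩ relabel (shiftIso a) ⁻¹' A) + 2 * τ) :=
          Finset.sum_le_sum fun a _ => hedge a
      _ = ∑ a, M.real (A ∩ relabel (shiftIso a) ⁻¹' A) + d * (2 * τ) := by
          rw [Finset.sum_add_distrib]
          simp
      _ ≤ d * (ε / 4 * ρ ^ 2 + 2 * τ) := by linarith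
      _ ≤ _ := by
          refine mul_le_mul_of_nonneg_left ?_ hd0'.le
          have h6 : (3 / 4 * ρ) ^ 2 ≤ ρ' ^ 2 := pow_le_pow_left₀ (by positivity) (by linarith) 2
          have := mul_le_mul_of_nonneg_left h6 hε.le
          have h7 : 0 ≤ ε * ρ ^ 2 := by positivity
          linarith
  have hρ'0 : 0 < ρ' := by linarith
  refine hd ρ' hρ'0 measureReal_le_one hρ' fun k δ q hk hδ0 hδ1 hq hq' =>
    density_entropy_le (isWeight_digitsWeight n) g hk hρ'0 hδ0 hδ1
      (sum_prodWeight_boolInd n n g) ((Finset.sum_le_sum fun a _ => ?_).trans hsum) hq hq'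
  rw [sum_prodWeight_boolInd (n + 1) n fun η =>
    g (fun u => η u.incl) && g fun u => η (u.translate a)]
  refine measureReal_mono fun ω hω => ?_
  -- The letter shift is its own inverse, so relabelling by it reads exactly the translated ball.
  exact (Bool.and_eq_true _ _).mp hω

end RegularTree

/-! ### Percolation processes as events for the labels. -/

namespace RegularTree

variable {d : ℕ}

/-- The neighbours of the root. -/
def letter (a : Fin d) : Vertex d := ⟨[a], List.isChain_singleton a⟩

theorem adj_root_iff {v : Vertex d} : (regularTree d).Adj (root d) v ↔ ∃ a, letter a = v := by
  refine exists_congr fun a => ?_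
  constructor
  · rintro (h | h)
    · exact Subtype.ext h.symm
    · simp [root] at h
  · rintro rfl
    exact Or.inl rfl

theorem letter_injective : Function.Injective (letter : Fin d → Vertex d) := fun a b h => by
  simpa [letter, Subtype.ext_iff] using h

theorem shiftIso_letter (a : Fin d) : shiftIso a (letter a) = root d := by
  simp [shiftIso, shift, letter, root]

/-- The automorphism of the tree that permutes the letters. -/
def permIso (s : Equiv.Perm (Fin d)) : regularTree d ≃g regularTree d where
  toFun v := ⟨v.1.map s, (List.isChain_map s).2 (v.2.imp fun _ _ h => s.injective.ne h)⟩
  invFun v := ⟨v.1.map s.symm, (List.isChain_map s.symm).2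
    (v.2.imp fun _ _ h => s.symm.injective.ne h)⟩
  left_inv v := by simp
  right_inv v := by simp
  map_rel_iff' := by
    intro u v
    refine ⟨?_, ?_⟩
    · rintro ⟨a, h⟩
      refine ⟨s.symm a, h.imp (fun h => ?_) fun h => ?_⟩ <;>
        simpa using congrArg (List.map s.symm) h
    · rintro ⟨a, h⟩
      refine ⟨s a, h.imp (fun h => ?_) fun h => ?_⟩ <;> simp [h]

theorem permIso_letter (s : Equiv.Perm (Fin d)) (a : Fin d) :
    permIso s (letter a) = letter (s a) := rfl

/-- The event that the root is occupied is equally correlated along all edges at the root. -/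
theorem measureReal_inter_shift_eq {f : (Vertex d → unitInterval) → Fin 2}
    (hf : IsFactor (regularTree d) (root d) f)
    (hγ : ∀ γ γ' : regularTree d ≃g regularTree d, γ.symm (root d) = γ'.symm (root d) →
      ∀ ω, f (relabel γ ω) = f (relabel γ' ω)) (a b : Fin d) :
    (labelMeasure (Vertex d)).real (f ⁻¹' {1} ∩ relabel (shiftIso b) ⁻¹' (f ⁻¹' {1})) =
      (labelMeasure (Vertex d)).real (f ⁻¹' {1} ∩ relabel (shiftIso a) ⁻¹' (f ⁻¹' {1})) := by
  have hA : MeasurableSet (f ⁻¹' {1}) := hf.measurable (measurableSet_singleton 1)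
  -- This root-preserving automorphism exchanges the neighbours a and b, and preserves both the
  -- label law and f.
  set π := permIso (Equiv.swap a b)
  have hπ : π (root d) = root d := rfl
  rw [← (measurePreserving_relabel π).measureReal_preimage
    (hA.inter (measurable_relabel (shiftIso a) hA)).nullMeasurableSet]
  congr 1
  ext ω
  have h1 : f (relabel (shiftIso b) ω) = f (relabel (shiftIso a) (relabel π ω)) :=
    hγ (shiftIso b) (π.trans (shiftIso a)) (by
      have hb : (shiftIso b).symm (root d) = letter b :=
        (RelIso.symm_apply_eq _).2 (shiftIso_letter b).symm
      rw [hb, eq_comm, RelIso.symm_apply_eq, RelIso.trans_apply, permIso_letter,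
        Equiv.swap_apply_right, shiftIso_letter]) ω
  simp only [Set.mem_inter_iff, Set.mem_preimage, Set.mem_singleton_iff, h1, hf.invariant π hπ]

/-- The densities of a percolation process that is a factor of independent labels, in terms of
one event for the labels. -/
theorem _root_.IsFIID.exists_event {Ω : Type*} [MeasurableSpace Ω] {P : Measure Ω}
    [IsProbabilityMeasure P] {Y : Vertex d → Ω → Fin 2}
    (hY : IsFIID (regularTree d) (root d) P Y) :
    ∃ A : Set (Vertex d → unitInterval), MeasurableSet A ∧ (∀ v, Measurable (Y v)) ∧
      (∀ v, P.real {x | Y v x = 1} = (labelMeasure (Vertex d)).real A) ∧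
      (∀ a, P.real {x | Y (root d) x = 1 ∧ Y (letter a) x = 1} =
        (labelMeasure (Vertex d)).real (A ∩ relabel (shiftIso a) ⁻¹' A)) ∧
      ∀ a b, (labelMeasure (Vertex d)).real (A ∩ relabel (shiftIso b) ⁻¹' A) =
        (labelMeasure (Vertex d)).real (A ∩ relabel (shiftIso a) ⁻¹' A) := by
  obtain ⟨X, f, hX, hf, hYf⟩ := hY
  have hA : MeasurableSet (f ⁻¹' {1}) := hf.measurable (measurableSet_singleton 1)
  have hXm : Measurable fun x v => X v x := measurable_pi_lambda _ hX.measurable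
  have hP : ∀ B : Set (Vertex d → unitInterval), MeasurableSet B →
      P.real ((fun x v => X v x) ⁻¹' B) = (labelMeasure (Vertex d)).real B := fun B hB => by
    rw [← hX.map_eq, map_measureReal_apply hXm hB]
  refine ⟨f ⁻¹' {1}, hA, fun v => ?_, fun v => ?_, fun a => ?_,
    measureReal_inter_shift_eq hf fun γ γ' h ω => ?_⟩
  · obtain ⟨γ, hγ⟩ := exists_iso_eq_root v
    rw [funext (hYf v γ hγ)]
    exact hf.measurable.comp ((measurable_relabel γ).comp hXm)
  · obtain ⟨γ, hγ⟩ := exists_iso_eq_root v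
    rw [← (measurePreserving_relabel γ).measureReal_preimage hA.nullMeasurableSet,
      ← hP _ (measurable_relabel γ hA)]
    simp only [hYf v γ hγ]
    rfl
  · rw [← hP _ (hA.inter (measurable_relabel (shiftIso a) hA))]
    simp only [hYf _ (shiftIso a) (shiftIso_letter a), hYf (root d) SimpleGraph.Iso.refl rfl]
    rfl
  · have h1 : (γ'.symm.trans γ) (root d) = root d := by
      rw [RelIso.trans_apply, ← h, RelIso.apply_symm_apply]
    rw [← hf.invariant _ h1 (relabel γ' ω)]
    congr 1
    funext v
    simp only [relabel]
    congr 1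
    rw [RelIso.symm_apply_eq]
    change v = γ (γ'.symm (γ' (γ.symm v)))
    simp

theorem avgDegree_eq {Ω : Type*} [MeasurableSpace Ω] {P : Measure Ω} [IsProbabilityMeasure P]
    {Y : Vertex d → Ω → Fin 2} (hY : ∀ v, Measurable (Y v)) :
    avgDegree (regularTree d) (root d) P Y =
      (∑ a, P.real {x | Y (root d) x = 1 ∧ Y (letter a) x = 1}) / P.real {x | Y (root d) x = 1} := by
  classical
  have hS : ∀ v, MeasurableSet {x | Y v x = 1} := fun v => hY v (measurableSet_singleton 1)
  have h1 : ∀ x, (Set.ncard {v | (regularTree d).Adj (root d) v ∧ Y v x = 1} : ℝ) =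
      ∑ a, {x | Y (letter a) x = 1}.indicator (fun _ => (1 : ℝ)) x := fun x => by
    have h2 : {v | (regularTree d).Adj (root d) v ∧ Y v x = 1} =
        ((Finset.univ.filter fun a => Y (letter a) x = 1).image letter : Finset (Vertex d)) := by
      ext v
      simp only [adj_root_iff, Finset.coe_image, Finset.coe_filter, Finset.mem_univ, true_and]
      constructor
      · rintro ⟨⟨a, rfl⟩, h⟩
        exact ⟨a, h, rfl⟩
      · rintro ⟨a, h, rfl⟩
        exact ⟨⟨a, rfl⟩, h⟩
    rw [h2, Set.ncard_coe_finset, Finset.card_image_of_injective _ letter_injective,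
      Finset.card_filter]
    push_cast
    exact Finset.sum_congr rfl fun a _ => by simp [Set.indicator_apply]
  rw [avgDegree]
  simp only [h1]
  rw [integral_finsetSum _ fun a _ => (integrable_const (1 : ℝ)).indicator (hS _), Finset.sum_div]
  refine Finset.sum_congr rfl fun a _ => ?_
  rw [integral_indicator_const _ (hS _), smul_eq_mul, mul_one, measureReal_def,
    ProbabilityTheory.cond_apply (hS _), ENNReal.toReal_mul, ENNReal.toReal_inv, inv_mul_eq_div]
  rfl

end RegularTree

/-! ### Conclusion. -/

theorem limsup_div_le_one {u v : ℕ → ℝ} (hv : ∀ᶠ d in atTop, 0 < v d)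
    (h : ∀ α : ℝ, 1 < α → ∀ᶠ d in atTop, u d ≤ α * v d) :
    limsup (fun d => ((u d / v d : ℝ) : EReal)) atTop ≤ 1 := by
  by_contra! hlt
  obtain ⟨α, h1, h2⟩ := EReal.lt_iff_exists_real_btwn.1 hlt
  refine h2.not_ge (limsup_le_of_le (by isBoundedDefault) ?_)
  filter_upwards [hv, h α (by exact_mod_cast h1)] with d hd hα
  exact EReal.coe_le_coe_iff.2 ((div_le_iff₀ hd).2 hα)

theorem theorem1
    {Ω : ℕ → Type*} [∀ d, MeasurableSpace (Ω d)]
    (P : ∀ d, Measure (Ω d)) [∀ d, IsProbabilityMeasure (P d)]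
    (Y : ∀ d, RegularTree.Vertex d → Ω d → Fin 2)
    (hY : ∀ d, IsFIID (regularTree d) (RegularTree.root d) (P d) (Y d)) :
    (∀ o' : ∀ d, RegularTree.Vertex d,
        (∀ d, 1 ≤ d → (regularTree d).Adj (RegularTree.root d) (o' d)) →
        Tendsto (fun d => corrRatio (RegularTree.root d) (o' d) (P d) (Y d)) atTop (𝓝 0) →
        limsup (fun d : ℕ =>
          ((density (RegularTree.root d) (P d) (Y d) / (Real.log d / d) : ℝ) : EReal)) atTop ≤ 1) ∧
    ((fun d : ℕ => avgDegree (regularTree d) (RegularTree.root d) (P d) (Y d))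
          =o[atTop] (fun d : ℕ => Real.log d) →
        limsup (fun d : ℕ =>
          ((density (RegularTree.root d) (P d) (Y d) / (Real.log d / d) : ℝ) : EReal)) atTop ≤ 1) := by
  have hpos : ∀ᶠ d : ℕ in atTop, 0 < Real.log d / d := by
    filter_upwards [eventually_gt_atTop 1] with d hd
    have : (1 : ℝ) < d := by exact_mod_cast hd
    exact div_pos (Real.log_pos this) (by linarith)
  choose A hA hYm hden hjoint hsymm using fun d => (hY d).exists_event
  constructor
  · intro o' ho' hcorr
    refine limsup_div_le_one hpos fun α hα => ?_
    obtain ⟨ε, hε, h⟩ := RegularTree.exists_edge_density_lower_bound hα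
    filter_upwards [h, hpos, hcorr.eventually_lt_const hε, eventually_ge_atTop 1]
      with d hd hd0 hdε hd1
    by_contra! hlt
    obtain ⟨b, hb⟩ := RegularTree.adj_root_iff.1 (ho' d hd1)
    rw [density, hden] at hlt
    have hρ : 0 < (labelMeasure (RegularTree.Vertex d)).real (A d) :=
      (mul_pos (by linarith) hd0).trans hlt
    have hsum := hd (A d) (hA d) hρ hlt.le
    rw [corrRatio, ← hb, hden, hden, hjoint, div_lt_iff₀ (mul_pos hρ hρ)] at hdε
    -- By symmetry all d edges have the probability of the edge to o', which the correlation ratio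
    -- keeps below ερ².
    rw [Finset.sum_congr rfl fun a _ => hsymm d b a] at hsum
    simp only [Finset.sum_const, Finset.card_univ, Fintype.card_fin, nsmul_eq_mul] at hsum
    have hd' : (0 : ℝ) ≤ d := Nat.cast_nonneg d
    have := mul_le_mul_of_nonneg_left hdε.le hd'
    linarith
  · intro havg
    refine limsup_div_le_one hpos fun α hα => ?_
    obtain ⟨ε, hε, h⟩ := RegularTree.exists_edge_density_lower_bound hα
    filter_upwards [h, hpos, havg.def (mul_pos hε (zero_lt_one.trans hα)), eventually_gt_atTop 0]
      with d hd hd0 hdε hd1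
    by_contra! hlt
    have hd' : (0 : ℝ) < d := by exact_mod_cast hd1
    rw [density, hden] at hlt
    have hρ : 0 < (labelMeasure (RegularTree.Vertex d)).real (A d) :=
      (mul_pos (by linarith) hd0).trans hlt
    have hsum := hd (A d) (hA d) hρ hlt.le
    have hlog : 0 < Real.log d := (div_pos_iff_of_pos_right hd').1 hd0
    rw [RegularTree.avgDegree_eq (hYm d), hden, Finset.sum_congr rfl fun a _ => hjoint d a,
      Real.norm_eq_abs, Real.norm_eq_abs, abs_of_pos hlog] at hdε
    have h1 := (div_le_iff₀ hρ).1 ((le_abs_self _).trans hdε)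
    rw [← mul_div_assoc, div_lt_iff₀ hd'] at hlt
    -- The average degree bounds the edge sum by εα(log d)ρ, and α log d < dρ makes this less than
    -- εdρ².
    have h2 := mul_lt_mul_of_pos_left hlt (mul_pos hε hρ)
    linarith
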